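/- Encode $n\ge 2$ fermionic modes into $n$ qubits by the ternary tree (TT) mapping. The qubits are the internal nodes $0,\dots,n-1$ of the balanced ternary tree in which the children of position $q$ are $3q+1,3q+2,3q+3$; its $2n+1$ leaves are the positions $n,\dots,3n$. The Majorana operator $\gamma_\ell$ of a leaf $\ell$ is the Pauli string that carries $X$, $Y$ or $Z$ at each node that the path from the root to $\ell$ leaves through its first, second or third child, and the identity elsewhere. Assign two leaves $\ell_j,\ell'_j$ to every mode $j$, all $2n$ of them distinct, and put $c_j=\tfrac12(\gamma_{\ell_j}+i\gamma_{\ell'_j})$. The one-body observables are the operators $c_i^\dagger c_j$, $i,j\in\{1,\dots,n\}$. A dynamic circuit for $n$-qubit states consists of a circuit $G$ on a register initialised in $|0\dots0\rangle$, a measurement of that register in the computational basis with outcome $r$, a circuit $F_r$ (depending on $r$) applied to one copy of the $n$-qubit state, and a measurement of the $n$ qubits in the computational basis. Circuits are built from layers of one- and two-qubit unitaries acting on disjoint sets of qubits; the depth is the number of layers of $G$ plus that of $F_r$, maximised over $r$. The dynamic circuit performs random Pauli measurements if for every $r$ and every qubit $v$ the operator $F_r^\dagger Z_vF_r$ is a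 Pauli string up to sign, so that each run measures a randomly selected family of $n$ commuting Pauli strings simultaneously. **Lemma.** There are absolute constants $C>0$ and $d\in\mathbb N$ such that for every $n\ge2$: 1. every TT Majorana operator $\gamma_\ell$ acts non-trivially on at most $\lceil\log_3(2n+1)\rceil$ qubits; 2. there is a single dynamic circuit of depth at most $d$, with a register of at most $2n$ qubits for $G$, that performs random Pauli measurements and has the following property. For every assignment of leaves to modes, every $\epsilon>0$ with $n\le 1/\epsilon^2$ and every $\delta\in(0,1)$ there are a number $$N\le C\,\frac{n\log(n/\delta)}{\epsilon^2}$$ and a classical estimator which, for every $n$-qubit state $\rho$, computes from the records of $N$ independent runs of this circuit, each on a single copy of $\rho$, numbers $\hat o_{ij}$ such that, with probability at least $1-\delta$, $$|\hat o_{ij}-\operatorname{tr}(\rho\,c_i^\dagger c_j)|\le\epsilon\quad\text{for all } i,j\text{ simultaneously.}$$ In particular, for any fixed failure probability $\delta$ the sample complexity is $O(n\log n/\epsilon^2)$. -/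

import Mathlib

open Matrix
open scoped ComplexOrder

noncomputable section

namespace FermionShadow

/-! ### Qubits and Pauli strings -/

/-- Computational basis states of a register of `m` qubits. -/
abbrev Bits (m : ℕ) : Type := Fin m → Fin 2

/-- Operators on `m` qubits, written in the computational basis. -/
abbrev Op (m : ℕ) : Type := Matrix (Bits m) (Bits m) ℂ

/-- A density matrix: positive semidefinite with trace one. -/
def IsState {m : ℕ} (ρ : Op m) : Prop := ρ.PosSemidef ∧ ρ.trace = 1

/-- The single-qubit Pauli matrices: `none` is the identity, `some 0`, `some 1`, `some 2`
are `X`, `Y`, `Z`. -/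
def pauli : Option (Fin 3) → Matrix (Fin 2) (Fin 2) ℂ
  | none => 1
  | some 0 => !![0, 1; 1, 0]
  | some 1 => !![0, -Complex.I; Complex.I, 0]
  | some 2 => !![1, 0; 0, -1]

/-- The tensor product of the Pauli matrices `s 0, …, s (m - 1)`. -/
def pauliString {m : ℕ} (s : Fin m → Option (Fin 3)) : Op m :=
  Matrix.of fun x y => ∏ v, pauli (s v) (x v) (y v)

/-- The locality of a Pauli string: the number of its non-identity letters. -/
def weight {m : ℕ} (s : Fin m → Option (Fin 3)) : ℕ :=
  (Finset.univ.filter fun v => s v ≠ none).card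

/-! ### The ternary tree mapping

The balanced ternary tree with `n` internal nodes is stored level by level: position `0` is the
root, the children of position `q` are `3 * q + 1`, `3 * q + 2`, `3 * q + 3`. The internal nodes
are the positions `0, …, n - 1` and carry the qubits; the leaves are the `2 * n + 1`
positions `n, …, 3 * n`. -/

/-- The letter at node `v` of the Pauli string of the path from the root to position `p`:
a path that leaves `v` through its first, second or third child gets `X`, `Y` or `Z` at `v`;
nodes that the path does not leave get the identity. -/
def pathLetter : ℕ → ℕ → Option (Fin 3)
  | 0, _ => none
  | p + 1, v => if v = p / 3 then some (Fin.ofNat 3 (p % 3)) else pathLetter (p / 3) v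
termination_by p => p
decreasing_by omega

/-- The Pauli string attached to leaf number `k`. -/
def leafString (n : ℕ) (k : Fin (2 * n + 1)) : Fin n → Option (Fin 3) :=
  fun v => pathLetter (n + k) v

/-- The `2 * n + 1` pairwise anticommuting Pauli operators of the ternary tree. -/
def treeMajorana (n : ℕ) (k : Fin (2 * n + 1)) : Op n := pauliString (leafString n k)

/-- The annihilation operator `c j = (γ + i γ') / 2` of mode `j`. Mode `j` owns the two leaves
`leaf (j, 0)` and `leaf (j, 1)`; one of the `2 * n + 1` leaves remains unused. -/
def annihilation {n : ℕ} (leaf : Fin n × Fin 2 ↪ Fin (2 * n + 1)) (j : Fin n) : Op n :=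
  (1 / 2 : ℂ) • (treeMajorana n (leaf (j, 0)) + Complex.I • treeMajorana n (leaf (j, 1)))

/-- The one-body observable `c i† c j`. -/
def oneBody {n : ℕ} (leaf : Fin n × Fin 2 ↪ Fin (2 * n + 1)) (i j : Fin n) : Op n :=
  (annihilation leaf i)ᴴ * annihilation leaf j

/-! ### Circuits and their depth -/

/-- A gate on a register of `m` qubits: a one-qubit or a two-qubit unitary. -/
inductive Gate (m : ℕ) : Type
  | one (i : Fin m) (U : Matrix.unitaryGroup (Fin 2) ℂ) : Gate m
  | two (i j : Fin m) (hij : i ≠ j) (U : Matrix.unitaryGroup (Fin 2 × Fin 2) ℂ) : Gate m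

namespace Gate

/-- The qubits on which a gate acts. -/
def support {m : ℕ} : Gate m → Finset (Fin m)
  | one i _ => {i}
  | two i j _ _ => {i, j}

/-- The operator of a gate on the whole register (identity on all other qubits). -/
def toOp {m : ℕ} : Gate m → Op m
  | one i U => Matrix.of fun x y =>
      if ∀ k, k ≠ i → x k = y k then (U : Matrix (Fin 2) (Fin 2) ℂ) (x i) (y i) else 0
  | two i j _ U => Matrix.of fun x y =>
      if ∀ k, k ≠ i → k ≠ j → x k = y k then
        (U : Matrix (Fin 2 × Fin 2) (Fin 2 × Fin 2) ℂ) (x i, x j) (y i, y j) else 0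

end Gate

/-- A layer: gates that act on pairwise disjoint sets of qubits, performed in one time step. -/
structure Layer (m : ℕ) : Type where
  gates : List (Gate m)
  disjoint : gates.Pairwise fun g h => Disjoint g.support h.support

/-- The operator of a layer (its gates commute). -/
def Layer.toOp {m : ℕ} (L : Layer m) : Op m := (L.gates.map Gate.toOp).prod

/-- A circuit: a list of layers, the head being performed first. Its depth is its length. -/
abbrev Circuit (m : ℕ) : Type := List (Layer m)

/-- The unitary of a circuit. -/
def circuitOp {m : ℕ} : Circuit m → Op m
  | [] => 1
  | L :: C => circuitOp C * L.toOp

/-! ### Single-copy measurement by one dynamic circuit -/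

/-- A dynamic measurement circuit for `n`-qubit states. The circuit `gen` is run on
`reg` qubits in the state `|0…0⟩`, which are then measured in the computational basis;
the classical outcome `r` is fed forward, and the circuit `feedback r` is
applied to one copy of the `n`-qubit state, which is then measured in the computational basis. -/
structure DynamicCircuit (n : ℕ) : Type where
  reg : ℕ
  gen : Circuit reg
  feedback : Bits reg → Circuit n

namespace DynamicCircuit

variable {n : ℕ}

/-- The depth of the whole dynamic circuit is at most `d`, whatever the message is. -/
def DepthLE (D : DynamicCircuit n) (d : ℕ) : Prop :=
  ∀ r, D.gen.length + (D.feedback r).length ≤ d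

/-- The dynamic circuit performs random Pauli measurements: for every message `r`, reading out
qubit `v` after `feedback r` amounts to measuring a Pauli string, up to a sign. So the message
selects at random a family of `n` commuting Pauli strings, which are measured simultaneously. -/
def MeasuresPaulis (D : DynamicCircuit n) : Prop :=
  ∀ (r : Bits D.reg) (v : Fin n), ∃ s : Fin n → Option (Fin 3), ∃ σ : ℤˣ,
    (circuitOp (D.feedback r))ᴴ * pauliString (fun w => if w = v then some 2 else none) *
      circuitOp (D.feedback r) = ((σ : ℤ) : ℂ) • pauliString s

/-- What one run records: the fed-forward message and the measured bits. -/
abbrev Record (D : DynamicCircuit n) : Type := Bits D.reg × Bits n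

/-- The Born probability of a record when the dynamic circuit is run on one copy of `ρ`. -/
def recordProb (D : DynamicCircuit n) (ρ : Op n) (x : D.Record) : ℝ :=
  ‖circuitOp D.gen x.1 0‖ ^ 2 *
    ((circuitOp (D.feedback x.1) * ρ * (circuitOp (D.feedback x.1))ᴴ) x.2 x.2).re

/-- The probability of the event `E` when the dynamic circuit is run independently on `N`
copies of `ρ`. -/
def prob (D : DynamicCircuit n) (ρ : Op n) (N : ℕ) (E : Set (Fin N → D.Record)) : ℝ :=
  ∑ data, E.indicator (fun z => ∏ t, D.recordProb ρ (z t)) data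

end DynamicCircuit

end FermionShadow

end

open scoped Kronecker

/-!
Two leaves of the ternary tree are mirror images of each other under a reflection of the tree: a
map that replaces the letter `t` of a path at level `j` by `s j - t` in `ℤ/3`. A reflection is an
involution that preserves depth, and it is given by one letter for each of the
`clog 3 (2 n + 1)` levels, so there are fewer than `3 (2 n + 1)` of them (`card_axes_lt`). If the
depths of the two leaves differ (by one, as the tree is balanced), the shorter path is first
extended by the last letter of the longer one (`exists_mirrored`).

Fix a reflection. Two internal nodes that it exchanges are measured jointly: the strings
`P_q ⊗ P_{s j - q}`, with `q` over the three letters, commute, so a two-qubit gate diagonalises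
them, a Bell measurement up to a cyclic shift of the letters. The other nodes are measured
in the letter `-s j` that the reflection fixes on their level. These gates act on
disjoint qubits and form one layer (`mirrorLayer`). The reflection exchanges the letters of
`P_q ⊗ P_{s j - q}`, hence two Majorana strings that are mirror images commute or anticommute alike
with each measured string (`Mirrored.stringSign_eq`). Their product therefore commutes with all
measured strings and becomes diagonal in the readout basis (`pairReadout_apply_of_ne`).

A layer of one-qubit gates on `2 n` qubits produces uniform bits, and a balanced function of them
selects every reflection with probability at least `1 / (15 n)` (`exists_balanced_axes`). Weighting
the diagonal entries by the inverse probability gives unbiased estimators for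
all products of two Majorana operators, with range and second moment at most `15 n`.
A Bernstein bound for the empirical means (`one_sub_le_sum_indicator`) and a union bound over
the `(2 n + 1) ^ 2` products give the sample size `O(n log (n / δ) / ε ^ 2)`; the hypothesis
`n ≤ 1 / ε ^ 2` absorbs the rounding of the sample size. Finally `c i† c j` is a combination of
four such products with coefficients of modulus `1 / 4`.
-/

noncomputable section

namespace FermionShadow

/-! ### Tensor products and local operators -/

/-- The tensor product of the one-qubit operators `A 0, …, A (m - 1)`. -/
def tensor {m : ℕ} (A : Fin m → Matrix (Fin 2) (Fin 2) ℂ) : Op m :=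
  Matrix.of fun x y => ∏ v, A v (x v) (y v)

theorem tensor_mul {m : ℕ} (A B : Fin m → Matrix (Fin 2) (Fin 2) ℂ) :
    tensor A * tensor B = tensor (fun v => A v * B v) := by
  ext x y
  simp only [tensor, Matrix.mul_apply, Matrix.of_apply, ← Finset.prod_mul_distrib]
  exact (Fintype.prod_sum fun v k => A v (x v) k * B v k (y v)).symm

theorem tensor_one {m : ℕ} : tensor (fun _ : Fin m => 1) = 1 := by
  ext x y
  simp only [tensor, Matrix.of_apply, Matrix.one_apply]
  by_cases h : x = y
  · simp [h]
  · obtain ⟨v, hv⟩ := Function.ne_iff.mp h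
    rw [if_neg h]
    exact Finset.prod_eq_zero (Finset.mem_univ v) (if_neg hv)

theorem tensor_smul {m : ℕ} (c : Fin m → ℂ) (A : Fin m → Matrix (Fin 2) (Fin 2) ℂ) :
    tensor (fun v => c v • A v) = (∏ v, c v) • tensor A := by
  ext x y
  simp [tensor, Finset.prod_mul_distrib]

theorem tensor_conjTranspose {m : ℕ} (A : Fin m → Matrix (Fin 2) (Fin 2) ℂ) :
    (tensor A)ᴴ = tensor (fun v => (A v)ᴴ) := by
  ext x y
  simp [tensor, Matrix.conjTranspose_apply]

theorem tensor_commute {m : ℕ} {A B : Fin m → Matrix (Fin 2) (Fin 2) ℂ}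
    (h : ∀ v, Commute (A v) (B v)) : Commute (tensor A) (tensor B) := by
  simp only [Commute, SemiconjBy, tensor_mul]
  exact congrArg tensor (funext h)

/-- The operator that acts as `A` on the qubits `i`, `j` and as the identity elsewhere. -/
def pairOp {m : ℕ} (i j : Fin m) (A : Matrix (Fin 2 × Fin 2) (Fin 2 × Fin 2) ℂ) : Op m :=
  Matrix.of fun x y => if ∀ k, k ≠ i → k ≠ j → x k = y k then A (x i, x j) (y i, y j) else 0

theorem pairOp_mul {m : ℕ} {i j : Fin m} (hij : i ≠ j)
    (A B : Matrix (Fin 2 × Fin 2) (Fin 2 × Fin 2) ℂ) :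
    pairOp i j A * pairOp i j B = pairOp i j (A * B) := by
  ext x y
  simp only [pairOp, Matrix.mul_apply, Matrix.of_apply]
  let e : Fin 2 × Fin 2 → Bits m := fun p => Function.update (Function.update x i p.1) j p.2
  have ei : ∀ p, e p i = p.1 := fun p => by simp [e, hij]
  have ej : ∀ p, e p j = p.2 := fun p => by simp [e]
  have ek : ∀ p k, k ≠ i → k ≠ j → e p k = x k := fun p k h h' => by simp [e, h, h']
  have einj : Function.Injective e := fun p q h =>
    Prod.ext (by rw [← ei p, ← ei q, h]) (by rw [← ej p, ← ej q, h])
  symm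
  have key : ∀ p : Fin 2 × Fin 2,
      (if ∀ k, k ≠ i → k ≠ j → x k = y k then A (x i, x j) p * B p (y i, y j) else 0) =
      (if ∀ k, k ≠ i → k ≠ j → x k = e p k then A (x i, x j) (e p i, e p j) else 0) *
      (if ∀ k, k ≠ i → k ≠ j → e p k = y k then B (e p i, e p j) (y i, y j) else 0) := by
    intro p
    rw [if_pos fun k h h' => (ek p k h h').symm, ei, ej]
    by_cases h : ∀ k, k ≠ i → k ≠ j → x k = y k
    · rw [if_pos h, if_pos fun k h1 h2 => (ek p k h1 h2).trans (h k h1 h2)]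
    · rw [if_neg h, if_neg, mul_zero]
      exact fun h' => h fun k h1 h2 => (ek p k h1 h2).symm.trans (h' k h1 h2)
  rw [← Fintype.sum_of_injective e einj _ _ ?_ key]
  · split_ifs with h
    · rfl
    · exact Finset.sum_const_zero.symm
  · intro z hz
    rw [if_neg, zero_mul]
    refine fun h => hz ⟨(z i, z j), funext fun k => ?_⟩
    by_cases hi : k = i
    · rw [hi, ei]
    by_cases hj : k = j
    · rw [hj, ej]
    rw [ek _ _ hi hj, h k hi hj]

theorem pairOp_smul {m : ℕ} (i j : Fin m) (c : ℂ)
    (A : Matrix (Fin 2 × Fin 2) (Fin 2 × Fin 2) ℂ) :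
    pairOp i j (c • A) = c • pairOp i j A := by
  ext x y
  simp [pairOp]

theorem pairOp_conjTranspose {m : ℕ} (i j : Fin m)
    (A : Matrix (Fin 2 × Fin 2) (Fin 2 × Fin 2) ℂ) :
    (pairOp i j A)ᴴ = pairOp i j Aᴴ := by
  ext x y
  simp only [pairOp, Matrix.conjTranspose_apply, Matrix.of_apply, apply_ite star, star_zero]
  simp only [eq_comm]

/-- A tensor product of operators on two different qubits, as a tensor product over the whole
register. -/
theorem pairOp_kronecker {m : ℕ} {i j : Fin m} (hij : i ≠ j) (A B : Matrix (Fin 2) (Fin 2) ℂ) :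
    pairOp i j (A ⊗ₖ B) = tensor (fun v => if v = i then A else if v = j then B else 1) := by
  ext x y
  simp only [pairOp, tensor, Matrix.of_apply, Matrix.kroneckerMap_apply]
  have hji := hij.symm
  by_cases h : ∀ k, k ≠ i → k ≠ j → x k = y k
  · rw [if_pos h, Fintype.prod_eq_mul i j hij]
    · simp [hji]
    · rintro k ⟨h1, h2⟩
      rw [if_neg h1, if_neg h2, h k h1 h2, Matrix.one_apply_eq]
  · rw [if_neg h]
    push Not at h
    obtain ⟨k, h1, h2, h3⟩ := h
    refine (Finset.prod_eq_zero (Finset.mem_univ k) ?_).symm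
    simp [h1, h2, h3]

theorem pairOp_one {m : ℕ} {i j : Fin m} (hij : i ≠ j) :
    pairOp i j (1 : Matrix (Fin 2 × Fin 2) (Fin 2 × Fin 2) ℂ) = 1 := by
  rw [← Matrix.one_kronecker_one, pairOp_kronecker hij, ← tensor_one]
  simp

theorem pairOp_commute_tensor {m : ℕ} {i j : Fin m} (hij : i ≠ j)
    (U : Matrix (Fin 2 × Fin 2) (Fin 2 × Fin 2) ℂ) {A : Fin m → Matrix (Fin 2) (Fin 2) ℂ}
    (hi : A i = 1) (hj : A j = 1) : Commute (tensor A) (pairOp i j U) := by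
  have hadd : ∀ p q, pairOp i j (p + q) = pairOp i j p + pairOp i j q := fun p q => by
    ext x y
    simp only [pairOp, Matrix.of_apply, Matrix.add_apply]
    split_ifs <;> simp
  induction U using Matrix.induction_on with
  | h_add p q hp hq => rw [hadd]; exact hp.add_right hq
  | h_std_basis p q c =>
    -- a matrix unit of the pair is a tensor product of one-qubit matrix units
    have : single p q c = c • (single p.1 q.1 (1 : ℂ) ⊗ₖ single p.2 q.2 (1 : ℂ)) := by
      rw [single_kronecker_single]; simp
    rw [this, pairOp_smul, pairOp_kronecker hij]
    refine (tensor_commute fun v => ?_).smul_right c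
    split_ifs with h1 h2
    · rw [h1, hi]; exact Commute.one_left _
    · rw [h2, hj]; exact Commute.one_left _
    · exact Commute.one_right _

theorem gate_one_toOp {m : ℕ} (i : Fin m) (U : Matrix.unitaryGroup (Fin 2) ℂ) :
    (Gate.one i U).toOp =
      tensor (fun v => if v = i then (U : Matrix (Fin 2) (Fin 2) ℂ) else 1) := by
  ext x y
  simp only [Gate.toOp, tensor, Matrix.of_apply]
  by_cases h : ∀ k, k ≠ i → x k = y k
  · rw [if_pos h, Fintype.prod_eq_single i]
    · simp
    · intro k h1
      rw [if_neg h1, h k h1, Matrix.one_apply_eq]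
  · rw [if_neg h]
    push Not at h
    obtain ⟨k, h1, h3⟩ := h
    refine (Finset.prod_eq_zero (Finset.mem_univ k) ?_).symm
    simp [h1, h3]

theorem gate_two_toOp {m : ℕ} (i j : Fin m) (hij : i ≠ j)
    (U : Matrix.unitaryGroup (Fin 2 × Fin 2) ℂ) :
    (Gate.two i j hij U).toOp = pairOp i j U := rfl

theorem pauliString_eq_tensor {m : ℕ} (s : Fin m → Option (Fin 3)) :
    pauliString s = tensor (fun v => pauli (s v)) := rfl

/-! ### Conjugating Pauli strings by gates and layers -/

theorem Gate.toOp_isometry {m : ℕ} (g : Gate m) : g.toOpᴴ * g.toOp = 1 := by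
  cases g with
  | one i U =>
    rw [gate_one_toOp, tensor_conjTranspose, tensor_mul, ← tensor_one]
    congr 1
    funext v
    split_ifs
    · exact Unitary.coe_star_mul_self U
    · simp
  | two i j hij U =>
    rw [gate_two_toOp, pairOp_conjTranspose, pairOp_mul hij, ← pairOp_one hij]
    exact congrArg _ (Unitary.coe_star_mul_self U)

theorem Gate.commute_pauliString {m : ℕ} (g : Gate m) {s : Fin m → Option (Fin 3)}
    (h : ∀ v ∈ g.support, s v = none) : Commute (pauliString s) g.toOp := by
  cases g with
  | one i U =>
    rw [gate_one_toOp]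
    refine tensor_commute fun v => ?_
    split_ifs with hv
    · rw [h v (by simp [Gate.support, hv])]; exact Commute.one_left _
    · exact Commute.one_right _
  | two i j hij U =>
    refine pairOp_commute_tensor hij _ ?_ ?_
    · rw [h i (by simp [Gate.support])]; rfl
    · rw [h j (by simp [Gate.support])]; rfl

theorem gates_prod_isometry {m : ℕ} (l : List (Gate m)) :
    (l.map Gate.toOp).prodᴴ * (l.map Gate.toOp).prod = 1 := by
  induction l with
  | nil => simp
  | cons g l ih =>
    rw [List.map_cons, List.prod_cons, conjTranspose_mul, Matrix.mul_assoc,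
      ← Matrix.mul_assoc g.toOpᴴ, g.toOp_isometry, Matrix.one_mul, ih]

theorem gates_prod_commute_pauliString {m : ℕ} (l : List (Gate m)) {s : Fin m → Option (Fin 3)}
    (h : ∀ g ∈ l, ∀ v ∈ g.support, s v = none) :
    Commute (pauliString s) (l.map Gate.toOp).prod := by
  refine Commute.list_prod_right _ _ fun A hA => ?_
  obtain ⟨g, hg, rfl⟩ := List.mem_map.mp hA
  exact g.commute_pauliString (h g hg)

/-- In a layer only the gate that meets the support of a Pauli string conjugates it. -/
theorem gates_prod_conj {m : ℕ} {l : List (Gate m)}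
    (hl : l.Pairwise fun g h => Disjoint g.support h.support) {g : Gate m} (hg : g ∈ l)
    {t s : Fin m → Option (Fin 3)} (ht : ∀ v, v ∉ g.support → t v = none)
    (hs : ∀ v, v ∉ g.support → s v = none)
    (hconj : g.toOpᴴ * pauliString t * g.toOp = pauliString s) :
    (l.map Gate.toOp).prodᴴ * pauliString t * (l.map Gate.toOp).prod = pauliString s := by
  induction l with
  | nil => simp at hg
  | cons k l ih =>
    obtain ⟨hk, hl⟩ := List.pairwise_cons.mp hl
    rw [List.map_cons, List.prod_cons, conjTranspose_mul]
    set P := (l.map Gate.toOp).prod with hP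
    have e : Pᴴ * k.toOpᴴ * pauliString t * (k.toOp * P) =
        Pᴴ * (k.toOpᴴ * pauliString t * k.toOp) * P := by simp only [Matrix.mul_assoc]
    rw [e]
    rcases List.mem_cons.mp hg with rfl | hg
    · rw [hconj, Matrix.mul_assoc,
        (gates_prod_commute_pauliString l fun g' hg' v hv => hs v fun hv' =>
          Finset.disjoint_left.mp (hk g' hg') hv' hv).eq, ← Matrix.mul_assoc,
        gates_prod_isometry, Matrix.one_mul]
    · rw [Matrix.mul_assoc k.toOpᴴ, (k.commute_pauliString fun v hv => ht v fun hv' =>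
          Finset.disjoint_left.mp (hk g hg) hv hv').eq, ← Matrix.mul_assoc k.toOpᴴ,
        k.toOp_isometry, Matrix.one_mul]
      exact ih hl hg

/-! ### One- and two-qubit basis changes -/

theorem conj_two : (starRingEnd ℂ) 2 = 2 := Complex.conj_ofNat 2

/-- The rotation by `2π/3` about the axis `(1, 1, 1)`, which permutes `X`, `Y`, `Z` cyclically. -/
def cyclicRotation : Matrix (Fin 2) (Fin 2) ℂ :=
  (1 / 2 : ℂ) • !![1 + Complex.I, 1 + Complex.I; -1 + Complex.I, 1 - Complex.I]

theorem cyclicRotation_mem : cyclicRotation ∈ Matrix.unitaryGroup (Fin 2) ℂ := by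
  rw [Matrix.mem_unitaryGroup_iff']
  ext i j
  fin_cases i <;> fin_cases j <;>
    simp [cyclicRotation, Matrix.mul_apply, Fin.sum_univ_two, Matrix.star_apply] <;>
    ring_nf <;> simp [conj_two] <;> norm_num

theorem cyclicRotation_conj (t : Fin 3) :
    cyclicRotationᴴ * pauli (some t) * cyclicRotation = pauli (some (t + 1)) := by
  ext i j
  fin_cases t <;> fin_cases i <;> fin_cases j <;>
    simp [cyclicRotation, Matrix.mul_apply, Fin.sum_univ_two, pauli,
      Matrix.conjTranspose_apply] <;>
    ring_nf <;> (try simp [conj_two]) <;> (try ring_nf)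

theorem exists_shift_letters (f : Fin 3) : ∃ V : Matrix.unitaryGroup (Fin 2) ℂ,
    ∀ t, (V : Matrix (Fin 2) (Fin 2) ℂ)ᴴ * pauli (some t) * (V : Matrix (Fin 2) (Fin 2) ℂ) =
      pauli (some (t + f)) := by
  have zero : ∃ V : Matrix.unitaryGroup (Fin 2) ℂ, ∀ t,
      (V : Matrix (Fin 2) (Fin 2) ℂ)ᴴ * pauli (some t) * (V : Matrix (Fin 2) (Fin 2) ℂ) =
        pauli (some (t + 0)) := ⟨1, fun t => by simp⟩
  have step : ∀ k : Fin 3, (∃ V : Matrix.unitaryGroup (Fin 2) ℂ, ∀ t,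
      (V : Matrix (Fin 2) (Fin 2) ℂ)ᴴ * pauli (some t) * (V : Matrix (Fin 2) (Fin 2) ℂ) =
        pauli (some (t + k))) → ∃ V : Matrix.unitaryGroup (Fin 2) ℂ, ∀ t,
      (V : Matrix (Fin 2) (Fin 2) ℂ)ᴴ * pauli (some t) * (V : Matrix (Fin 2) (Fin 2) ℂ) =
        pauli (some (t + (k + 1))) := by
    rintro k ⟨V, hV⟩
    refine ⟨V * ⟨cyclicRotation, cyclicRotation_mem⟩, fun t => ?_⟩
    rw [← add_assoc, ← cyclicRotation_conj, ← hV]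
    simp only [Submonoid.coe_mul, conjTranspose_mul, Matrix.mul_assoc]
  fin_cases f
  · exact zero
  · exact step 0 zero
  · exact step 1 (step 0 zero)

/-- The change from the computational basis to the joint eigenbasis of `Z ⊗ Z` and `X ⊗ Y`. -/
def bellMatrix : Matrix (Fin 2 × Fin 2) (Fin 2 × Fin 2) ℂ :=
  Matrix.of fun p q => ((1 + Complex.I) / 2) *
    (if p.1 = 0 then
      (if q = (0, 0) then 1 else if q = (1, 1) then (if p.2 = 0 then -Complex.I else Complex.I)
        else 0)
    else
      (if q = (0, 1) then 1 else if q = (1, 0) then (if p.2 = 0 then Complex.I else -Complex.I)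
        else 0))

theorem bellMatrix_mem : bellMatrix ∈ Matrix.unitaryGroup (Fin 2 × Fin 2) ℂ := by
  rw [Matrix.mem_unitaryGroup_iff']
  ext ⟨i, i'⟩ ⟨j, j'⟩
  fin_cases i <;> fin_cases j <;> fin_cases i' <;> fin_cases j' <;>
    simp [bellMatrix, Matrix.mul_apply, Fintype.sum_prod_type, Fin.sum_univ_two,
      Matrix.star_apply] <;>
    ring_nf <;> simp [conj_two] <;> norm_num

theorem bellMatrix_conj_fst : bellMatrixᴴ * (pauli (some 2) ⊗ₖ pauli none) * bellMatrix =
    pauli (some 2) ⊗ₖ pauli (some 2) := by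
  ext ⟨i, i'⟩ ⟨j, j'⟩
  fin_cases i <;> fin_cases j <;> fin_cases i' <;> fin_cases j' <;>
    simp [bellMatrix, Matrix.mul_apply, Fintype.sum_prod_type, Fin.sum_univ_two, pauli,
      Matrix.conjTranspose_apply, Matrix.kroneckerMap_apply, Matrix.one_apply] <;>
    ring_nf <;> simp [conj_two] <;> norm_num

theorem bellMatrix_conj_snd : bellMatrixᴴ * (pauli none ⊗ₖ pauli (some 2)) * bellMatrix =
    pauli (some 0) ⊗ₖ pauli (some 1) := by
  ext ⟨i, i'⟩ ⟨j, j'⟩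
  fin_cases i <;> fin_cases j <;> fin_cases i' <;> fin_cases j' <;>
    simp [bellMatrix, Matrix.mul_apply, Fintype.sum_prod_type, Fin.sum_univ_two, pauli,
      Matrix.conjTranspose_apply, Matrix.kroneckerMap_apply, Matrix.one_apply] <;>
    ring_nf <;> simp [conj_two] <;> ring_nf

theorem exists_basis_change (f : Fin 3) : ∃ V : Matrix.unitaryGroup (Fin 2) ℂ,
    (V : Matrix (Fin 2) (Fin 2) ℂ)ᴴ * pauli (some 2) * (V : Matrix (Fin 2) (Fin 2) ℂ) =
      pauli (some f) := by
  obtain ⟨V, hV⟩ := exists_shift_letters (f + 1)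
  have h : 2 + (f + 1) = f := by clear hV; revert f; decide
  exact ⟨V, by rw [hV, h]⟩

/-- Both products `P_q ⊗ P_{-f-q}` that are measured jointly on a pair of mirror nodes come from
the Bell basis of `Z ⊗ Z` and `X ⊗ Y` by one simultaneous cyclic shift of the letters. -/
theorem exists_pair_basis_change (f : Fin 3) : ∃ U : Matrix.unitaryGroup (Fin 2 × Fin 2) ℂ,
    (U : Matrix (Fin 2 × Fin 2) (Fin 2 × Fin 2) ℂ)ᴴ * (pauli (some 2) ⊗ₖ pauli none) *
        (U : Matrix (Fin 2 × Fin 2) (Fin 2 × Fin 2) ℂ) =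
      pauli (some f) ⊗ₖ pauli (some f) ∧
    (U : Matrix (Fin 2 × Fin 2) (Fin 2 × Fin 2) ℂ)ᴴ * (pauli none ⊗ₖ pauli (some 2)) *
        (U : Matrix (Fin 2 × Fin 2) (Fin 2 × Fin 2) ℂ) =
      pauli (some (f + 1)) ⊗ₖ pauli (some (f + 2)) := by
  obtain ⟨V, hV⟩ := exists_shift_letters (f + 1)
  have h0 : 0 + (f + 1) = f + 1 := zero_add _
  have h1 : 1 + (f + 1) = f + 2 := by clear hV; revert f; decide
  have h2 : 2 + (f + 1) = f := by clear hV; revert f; decide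
  have hVV : (V : Matrix (Fin 2) (Fin 2) ℂ) ⊗ₖ (V : Matrix (Fin 2) (Fin 2) ℂ) ∈
      Matrix.unitaryGroup (Fin 2 × Fin 2) ℂ :=
    Matrix.kronecker_mem_unitary V.2 V.2
  have conj : ∀ A B C : Matrix (Fin 2 × Fin 2) (Fin 2 × Fin 2) ℂ,
      (B * C)ᴴ * A * (B * C) = Cᴴ * (Bᴴ * A * B) * C := fun A B C => by
    simp only [conjTranspose_mul, Matrix.mul_assoc]
  refine ⟨⟨bellMatrix, bellMatrix_mem⟩ * ⟨_, hVV⟩, ?_, ?_⟩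
  · rw [Submonoid.coe_mul, conj, bellMatrix_conj_fst, Matrix.conjTranspose_kronecker,
      ← Matrix.mul_kronecker_mul, ← Matrix.mul_kronecker_mul, hV, h2]
  · rw [Submonoid.coe_mul, conj, bellMatrix_conj_snd, Matrix.conjTranspose_kronecker,
      ← Matrix.mul_kronecker_mul, ← Matrix.mul_kronecker_mul, hV, hV, h0, h1]

/-! ### Depth and paths in the ternary tree -/

/-- The depth of a position of the ternary tree; the root has depth `0`. -/
def nodeDepth : ℕ → ℕ
  | 0 => 0
  | p + 1 => nodeDepth (p / 3) + 1
termination_by p => p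
decreasing_by omega

theorem nodeDepth_zero : nodeDepth 0 = 0 := by rw [nodeDepth]

theorem nodeDepth_succ (p : ℕ) : nodeDepth (p + 1) = nodeDepth (p / 3) + 1 := by rw [nodeDepth]

theorem nodeDepth_child (q : ℕ) (t : Fin 3) : nodeDepth (3 * q + 1 + t) = nodeDepth q + 1 := by
  rw [show 3 * q + 1 + (t : ℕ) = 3 * q + t + 1 by omega, nodeDepth_succ,
    show (3 * q + (t : ℕ)) / 3 = q by omega]

theorem pathLetter_zero (v : ℕ) : pathLetter 0 v = none := by rw [pathLetter]

theorem pathLetter_child (q : ℕ) (t : Fin 3) (v : ℕ) :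
    pathLetter (3 * q + 1 + t) v = if v = q then some t else pathLetter q v := by
  rw [show 3 * q + 1 + (t : ℕ) = 3 * q + t + 1 by omega, pathLetter,
    show (3 * q + (t : ℕ)) / 3 = q by omega,
    show Fin.ofNat 3 ((3 * q + (t : ℕ)) % 3) = t from Fin.ext (by simp [Fin.ofNat])]

/-- Induction along the paths of the ternary tree. -/
theorem tree_induction {P : ℕ → Prop} (root : P 0)
    (child : ∀ (q : ℕ) (t : Fin 3), P q → P (3 * q + 1 + t)) (p : ℕ) : P p := by
  induction p using Nat.strong_induction_on with
  | _ p ih =>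
    rcases p with _ | p
    · exact root
    · have := child (p / 3) ⟨p % 3, by omega⟩ (ih _ (by omega))
      rwa [show 3 * (p / 3) + 1 + p % 3 = p + 1 by omega] at this

theorem exists_eq_child {p : ℕ} (hp : p ≠ 0) : ∃ (q : ℕ) (t : Fin 3), p = 3 * q + 1 + t :=
  ⟨(p - 1) / 3, ⟨(p - 1) % 3, by omega⟩, by simp only; omega⟩

theorem pow_nodeDepth_le (p : ℕ) : 3 ^ nodeDepth p ≤ 2 * p + 1 := by
  induction p using tree_induction with
  | root => simp [nodeDepth_zero]
  | child q t ih => rw [nodeDepth_child, pow_succ]; omega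

theorem le_pow_nodeDepth (p : ℕ) : 2 * p + 3 ≤ 3 ^ (nodeDepth p + 1) := by
  induction p using tree_induction with
  | root => simp [nodeDepth_zero]
  | child q t ih => rw [nodeDepth_child, pow_succ]; omega

/-- Beyond the root, `3 ^ nodeDepth p` is a multiple of three that is at most `6 * n + 1`, hence
at most `6 * n`; without this the bound would fail by rounding. -/
theorem nodeDepth_le_clog {n p : ℕ} (hp : p ≤ 3 * n) : nodeDepth p ≤ Nat.clog 3 (2 * n + 1) := by
  rcases Nat.eq_zero_or_pos (nodeDepth p) with h0 | h0
  · omega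
  obtain ⟨k, hk⟩ : ∃ k, nodeDepth p = k + 1 := ⟨nodeDepth p - 1, by omega⟩
  have h1 := pow_nodeDepth_le p
  have h2 : 2 * n + 1 ≤ 3 ^ Nat.clog 3 (2 * n + 1) := Nat.le_pow_clog (by norm_num) _
  rw [hk, pow_succ] at h1
  have h3 : 3 ^ k < 3 ^ Nat.clog 3 (2 * n + 1) := by omega
  have := (Nat.pow_lt_pow_iff_right (by norm_num : 1 < 3)).mp h3
  omega

theorem pathLetter_eq_none {p v : ℕ} (h : p ≤ 3 * v) : pathLetter p v = none := by
  induction p using tree_induction with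
  | root => exact pathLetter_zero v
  | child q t ih => rw [pathLetter_child, if_neg (by omega), ih (by omega)]

theorem card_pathLetter_le (p m : ℕ) :
    ((Finset.range m).filter fun v => pathLetter p v ≠ none).card ≤ nodeDepth p := by
  induction p using tree_induction with
  | root => simp [pathLetter_zero]
  | child q t ih =>
    rw [nodeDepth_child]
    refine (Finset.card_le_card (t := insert q
      ((Finset.range m).filter fun v => pathLetter q v ≠ none)) fun v hv => ?_).trans
      ((Finset.card_insert_le _ _).trans (Nat.succ_le_succ ih))
    rw [Finset.mem_filter, pathLetter_child] at hv
    rw [Finset.mem_insert, Finset.mem_filter]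
    by_cases h : v = q
    · exact Or.inl h
    · rw [if_neg h] at hv
      exact Or.inr hv

theorem weight_leafString_le {n : ℕ} (k : Fin (2 * n + 1)) :
    weight (leafString n k) ≤ Nat.clog 3 (2 * n + 1) := by
  refine le_trans ?_ ((card_pathLetter_le (n + k) n).trans (nodeDepth_le_clog (by omega)))
  refine Finset.card_le_card_of_injOn (fun v => (v : ℕ)) (fun v hv => ?_) fun v _ w _ h =>
    Fin.ext h
  have := (Finset.mem_filter.mp hv).2
  simpa [leafString] using this

/-! ### Reflections of the tree -/

/-- The reflection of the infinite ternary tree that replaces the letter `t` of a path at level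
`j` by `s j - t`. It is an involution that preserves depth; one node on every level is fixed. -/
def reflect (s : ℕ → Fin 3) : ℕ → ℕ
  | 0 => 0
  | p + 1 => 3 * reflect s (p / 3) + 1 + (s (nodeDepth (p / 3)) - Fin.ofNat 3 (p % 3) : Fin 3)
termination_by p => p
decreasing_by omega

theorem reflect_zero (s : ℕ → Fin 3) : reflect s 0 = 0 := by rw [reflect]

theorem reflect_child (s : ℕ → Fin 3) (q : ℕ) (t : Fin 3) :
    reflect s (3 * q + 1 + t) = 3 * reflect s q + 1 + (s (nodeDepth q) - t : Fin 3) := by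
  rw [show 3 * q + 1 + (t : ℕ) = 3 * q + t + 1 by omega, reflect,
    show (3 * q + (t : ℕ)) / 3 = q by omega,
    show Fin.ofNat 3 ((3 * q + (t : ℕ)) % 3) = t from Fin.ext (by simp [Fin.ofNat])]

theorem nodeDepth_reflect (s : ℕ → Fin 3) (p : ℕ) : nodeDepth (reflect s p) = nodeDepth p := by
  induction p using tree_induction with
  | root => rw [reflect_zero]
  | child q t ih => rw [reflect_child, nodeDepth_child, nodeDepth_child, ih]

theorem reflect_reflect (s : ℕ → Fin 3) (p : ℕ) : reflect s (reflect s p) = p := by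
  induction p using tree_induction with
  | root => rw [reflect_zero, reflect_zero]
  | child q t ih => rw [reflect_child, reflect_child, ih, nodeDepth_reflect, sub_sub_cancel]

theorem reflect_congr {s s' : ℕ → Fin 3} {p : ℕ} (h : ∀ j < nodeDepth p, s j = s' j) :
    reflect s p = reflect s' p := by
  induction p using tree_induction with
  | root => rw [reflect_zero, reflect_zero]
  | child q t ih =>
    rw [nodeDepth_child] at h
    rw [reflect_child, reflect_child, ih fun j hj => h j (by omega), h _ (by omega)]

/-- A reflection carries the letters along a path to the reflected letters along the reflected
path. -/
theorem pathLetter_reflect (s : ℕ → Fin 3) (p v : ℕ) :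
    pathLetter (reflect s p) v =
      (pathLetter p (reflect s v)).map fun t => s (nodeDepth v) - t := by
  induction p using tree_induction with
  | root => simp [reflect_zero, pathLetter_zero]
  | child q t ih =>
    rw [reflect_child, pathLetter_child, pathLetter_child, ih]
    by_cases h : v = reflect s q
    · rw [if_pos h, if_pos (by rw [h, reflect_reflect]), h, nodeDepth_reflect, Option.map_some]
    · rw [if_neg h, if_neg fun h' => h (by rw [← h', reflect_reflect])]

/-- Two positions of the same depth are exchanged by a reflection. -/
theorem exists_reflect_eq {p q : ℕ} (h : nodeDepth p = nodeDepth q) :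
    ∃ s : ℕ → Fin 3, reflect s p = q ∧ ∀ j, nodeDepth p ≤ j → s j = 0 := by
  induction p using tree_induction generalizing q with
  | root =>
    refine ⟨fun _ => 0, ?_, fun _ _ => rfl⟩
    rcases q with _ | q
    · exact reflect_zero _
    · rw [nodeDepth_zero, nodeDepth_succ] at h; omega
  | child p t ih =>
    rcases eq_or_ne q 0 with rfl | hq
    · rw [nodeDepth_zero, nodeDepth_child] at h; omega
    obtain ⟨q, u, rfl⟩ := exists_eq_child hq
    rw [nodeDepth_child, nodeDepth_child] at h
    obtain ⟨s, hs, hs0⟩ := ih (q := q) (by omega)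
    refine ⟨Function.update s (nodeDepth p) (t + u), ?_, fun j hj => ?_⟩
    · rw [reflect_child, Function.update_self, add_sub_cancel_left,
        reflect_congr (s' := s) fun j hj => Function.update_of_ne (by omega) _ _, hs]
    · rw [nodeDepth_child] at hj
      rw [Function.update_of_ne (by omega), hs0 j (by omega)]

/-- The sign by which two one-qubit Pauli matrices commute. -/
def letterSign : Option (Fin 3) → Option (Fin 3) → ℂ
  | some p, some q => if p = q then 1 else -1
  | _, _ => 1

theorem letterSign_none_left (q : Option (Fin 3)) : letterSign none q = 1 := rfl

theorem letterSign_none_right (q : Option (Fin 3)) : letterSign q none = 1 := by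
  cases q <;> rfl

theorem letterSign_map_sub (s : Fin 3) (p : Option (Fin 3)) (q : Fin 3) :
    letterSign (p.map fun t => s - t) (some q) = letterSign p (some (s - q)) := by
  rcases p with _ | p
  · rfl
  · have : s - p = q ↔ p = s - q := by revert s p q; decide
    simp [letterSign, this]

/-- The letter strings `a` and `b` on the nodes below `n` are mirror images under the reflection
by `s`: exactly so on nodes whose mirror image lies below `n`, and up to commutation with the fixed
letter `-s j` on the other nodes, where only that letter is measured. -/
structure Mirrored (n : ℕ) (s : ℕ → Fin 3) (a b : ℕ → Option (Fin 3)) : Prop where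
  map : ∀ v, v < n → reflect s v < n →
    b v = (a (reflect s v)).map fun t => s (nodeDepth v) - t
  sign : ∀ v, v < n → n ≤ reflect s v →
    letterSign (a v) (some (-s (nodeDepth v))) = letterSign (b v) (some (-s (nodeDepth v)))

theorem Mirrored.symm {n : ℕ} {s : ℕ → Fin 3} {a b : ℕ → Option (Fin 3)}
    (h : Mirrored n s a b) : Mirrored n s b a where
  map v hv hv' := by
    rw [h.map _ hv' (by rwa [reflect_reflect]), reflect_reflect, nodeDepth_reflect]
    cases a v <;> simp
  sign v hv hv' := (h.sign v hv hv').symm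

theorem exists_mirrored_of_depth_le {n p q : ℕ} (hp : n ≤ p) (hq : n ≤ q) (hp' : p ≤ 3 * n)
    (hq' : q ≤ 3 * n) (hpq : nodeDepth p ≤ nodeDepth q) :
    ∃ s : ℕ → Fin 3, (∀ j, nodeDepth q ≤ j → s j = 0) ∧
      Mirrored n s (pathLetter p) (pathLetter q) := by
  have hle : nodeDepth q ≤ nodeDepth p + 1 := by
    have h1 := pow_nodeDepth_le q
    have h2 := le_pow_nodeDepth p
    have h3 : 3 ^ nodeDepth q < 3 ^ (nodeDepth p + 2) := by
      rw [pow_succ 3 (nodeDepth p + 1)]; omega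
    have := (Nat.pow_lt_pow_iff_right (by norm_num : 1 < 3)).mp h3
    omega
  rcases hpq.eq_or_lt with h | h
  · obtain ⟨s, hs, hs0⟩ := exists_reflect_eq h
    refine ⟨s, fun j hj => hs0 j (by omega), fun v _ _ => ?_, fun v _ hv => ?_⟩
    · rw [← hs, pathLetter_reflect]
    · have hb : pathLetter q v = none := by
        rw [← hs, pathLetter_reflect, pathLetter_eq_none (by omega : p ≤ 3 * reflect s v)]; rfl
      have ha : pathLetter p v = none := by
        rw [← reflect_reflect s p, hs, pathLetter_reflect,
          pathLetter_eq_none (by omega : q ≤ 3 * reflect s v)]; rfl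
      rw [ha, hb]
  · obtain ⟨q, u, rfl⟩ := exists_eq_child (p := q) (by rintro rfl; rw [nodeDepth_zero] at h; omega)
    rw [nodeDepth_child] at h hle
    obtain ⟨s, hs, hs0⟩ := exists_reflect_eq (p := p) (q := q) (by omega)
    have hqn : q < n := by omega
    have hk : nodeDepth p = nodeDepth q := by omega
    -- The shorter path is extended by the letter `u`; at the new level the reflection must fix `u`.
    set s' := Function.update s (nodeDepth p) (-u) with hs'
    have hr : reflect s' p = q := by
      rw [← hs]
      exact reflect_congr fun j hj => Function.update_of_ne (by omega) _ _
    have hsk : s' (nodeDepth p) = -u := Function.update_self _ _ _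
    have huu : -u - u = u := (by decide : ∀ t : Fin 3, -t - t = t) u
    have hr' : reflect s' (3 * p + 1 + u) = 3 * q + 1 + u := by
      rw [reflect_child, hr, hsk, huu]
    refine ⟨s', fun j hj => ?_, fun v _ hv => ?_, fun v hvn hv => ?_⟩
    · rw [nodeDepth_child] at hj
      rw [hs', Function.update_of_ne (by omega), hs0 j (by omega)]
    · rw [← hr', pathLetter_reflect, pathLetter_child, if_neg (by omega)]
    · have ha : pathLetter p v = none := by
        have : pathLetter (3 * p + 1 + u) v = none := by
          rw [← reflect_reflect s' (3 * p + 1 + u), hr', pathLetter_reflect,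
            pathLetter_eq_none (by omega : 3 * q + 1 + u ≤ 3 * reflect s' v)]; rfl
        rwa [pathLetter_child, if_neg (by omega)] at this
      rw [ha, letterSign_none_left, pathLetter_child]
      by_cases hvq : v = q
      · rw [if_pos hvq, hvq, ← hk, hsk, neg_neg]
        simp [letterSign]
      · rw [if_neg hvq]
        have : pathLetter q v = none := by
          rw [← hr, pathLetter_reflect, pathLetter_eq_none (by omega : p ≤ 3 * reflect s' v)]; rfl
        rw [this, letterSign_none_left]

/-- Any two leaves are mirror images for one of the reflections given by `clog 3 (2 n + 1)`
letters. -/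
theorem exists_mirrored {n p q : ℕ} (hp : n ≤ p) (hq : n ≤ q) (hp' : p ≤ 3 * n)
    (hq' : q ≤ 3 * n) : ∃ s : ℕ → Fin 3, (∀ j, Nat.clog 3 (2 * n + 1) ≤ j → s j = 0) ∧
      Mirrored n s (pathLetter p) (pathLetter q) := by
  rcases le_total (nodeDepth p) (nodeDepth q) with h | h
  · obtain ⟨s, h0, hs⟩ := exists_mirrored_of_depth_le hp hq hp' hq' h
    exact ⟨s, fun j hj => h0 j ((nodeDepth_le_clog hq').trans hj), hs⟩
  · obtain ⟨s, h0, hs⟩ := exists_mirrored_of_depth_le hq hp hq' hp' h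
    exact ⟨s, fun j hj => h0 j ((nodeDepth_le_clog hp').trans hj), hs.symm⟩

/-! ### The mirror measurement -/

/-- The mirror image of a node, or the node itself if its mirror image is not an internal node. -/
def partner {n : ℕ} (s : ℕ → Fin 3) (v : Fin n) : Fin n :=
  if h : reflect s v < n then ⟨reflect s v, h⟩ else v

theorem partner_partner {n : ℕ} (s : ℕ → Fin 3) (v : Fin n) : partner s (partner s v) = v := by
  by_cases h : reflect s v < n
  · have : partner s v = ⟨reflect s v, h⟩ := dif_pos h
    rw [this]
    apply Fin.ext
    simp [partner, reflect_reflect]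
  · have : partner s v = v := dif_neg h
    rw [this, this]

theorem partner_val_of_ne {n : ℕ} {s : ℕ → Fin 3} {v : Fin n} (h : partner s v ≠ v) :
    (partner s v : ℕ) = reflect s v := by
  unfold partner at h ⊢
  split_ifs at h ⊢ <;> simp_all

theorem nodeDepth_partner {n : ℕ} (s : ℕ → Fin 3) (v : Fin n) :
    nodeDepth (partner s v) = nodeDepth v := by
  by_cases h : partner s v = v
  · rw [h]
  · rw [partner_val_of_ne h, nodeDepth_reflect]

/-- The letter `-s j` fixed by the reflection at the level `j` of the node `v`. -/
def axis (s : ℕ → Fin 3) (v : ℕ) : Fin 3 := -s (nodeDepth v)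

/-- The Pauli string that is read out on qubit `v`: the axis letter on a node without partner, and
one of the two strings `P_q ⊗ P_{s - q}`, `q = axis, axis + 1`, on a pair of mirror nodes. -/
def measuredString {n : ℕ} (s : ℕ → Fin 3) (v : Fin n) : Fin n → Option (Fin 3) := fun w =>
  if v ≤ partner s v then
    if w = v then some (axis s v) else if w = partner s v then some (axis s v) else none
  else
    if w = partner s v then some (axis s v + 1) else if w = v then some (axis s v + 2) else none

/-- The gate at the smaller node `v` of a pair of mirror nodes, or at an unpaired node. -/
def mirrorGate {n : ℕ} (s : ℕ → Fin 3) (v : Fin n) : Gate n :=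
  if h : v = partner s v then Gate.one v (exists_basis_change (axis s v)).choose
  else Gate.two v (partner s v) h (exists_pair_basis_change (axis s v)).choose

theorem mirrorGate_support {n : ℕ} (s : ℕ → Fin 3) (v : Fin n) :
    (mirrorGate s v).support = {v, partner s v} := by
  unfold mirrorGate
  split_ifs with h
  · rw [← h]; simp [Gate.support]
  · rfl

/-- The layer that measures all pairs of mirror nodes. -/
def mirrorLayer (n : ℕ) (s : ℕ → Fin 3) : Layer n where
  gates := ((List.finRange n).filter fun v => v ≤ partner s v).map (mirrorGate s)
  disjoint := by
    rw [List.pairwise_map]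
    refine List.Pairwise.imp_of_mem ?_ ((List.nodup_finRange n).filter _)
    intro v w hv hw hvw
    simp only [List.mem_filter, List.mem_finRange, true_and, decide_eq_true_eq] at hv hw
    rw [mirrorGate_support, mirrorGate_support, Finset.disjoint_left]
    intro u hu hu'
    simp only [Finset.mem_insert, Finset.mem_singleton] at hu hu'
    rcases hu with rfl | rfl <;> rcases hu' with h | h
    · exact hvw h
    · rw [h, partner_partner] at hv
      exact hvw (h.trans (le_antisymm hv hw))
    · rw [← h, partner_partner] at hw
      exact hvw ((le_antisymm hv hw).trans h)
    · exact hvw (by rw [← partner_partner s v, h, partner_partner])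

theorem pauliString_pair {m : ℕ} {i j : Fin m} (hij : i ≠ j) (p q : Option (Fin 3)) :
    pauliString (fun w => if w = i then p else if w = j then q else none) =
      pairOp i j (pauli p ⊗ₖ pauli q) := by
  rw [pairOp_kronecker hij, pauliString_eq_tensor]
  congr 1
  funext w
  split_ifs <;> rfl

theorem mirrorLayer_conj {n : ℕ} (s : ℕ → Fin 3) (v : Fin n) :
    (mirrorLayer n s).toOpᴴ * pauliString (fun w => if w = v then some 2 else none) *
      (mirrorLayer n s).toOp = pauliString (measuredString s v) := by
  have mem : ∀ u : Fin n, u ≤ partner s u → mirrorGate s u ∈ (mirrorLayer n s).gates :=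
    fun u hu => List.mem_map.mpr ⟨u, by simpa using hu, rfl⟩
  rcases le_or_gt v (partner s v) with h | h
  · refine gates_prod_conj (mirrorLayer n s).disjoint (mem v h) ?_ ?_ ?_
    · intro w hw
      rw [mirrorGate_support] at hw
      simp only [Finset.mem_insert, Finset.mem_singleton, not_or] at hw
      rw [if_neg hw.1]
    · intro w hw
      rw [mirrorGate_support] at hw
      simp only [Finset.mem_insert, Finset.mem_singleton, not_or] at hw
      rw [measuredString, if_pos h, if_neg hw.1, if_neg hw.2]
    · by_cases he : v = partner s v
      · rw [mirrorGate, dif_pos he, gate_one_toOp, pauliString_eq_tensor, pauliString_eq_tensor,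
          tensor_conjTranspose, tensor_mul, tensor_mul]
        congr 1
        funext w
        rw [measuredString, if_pos h, ← he]
        by_cases hw : w = v
        · simp only [if_pos hw]
          exact (exists_basis_change (axis s v)).choose_spec
        · simp [if_neg hw, pauli]
      · have e1 : (fun w => if w = v then some (2 : Fin 3) else none) =
            fun w => if w = v then some 2 else if w = partner s v then none else none := by
          funext w; simp
        have e2 : measuredString s v = fun w => if w = v then some (axis s v) else
            if w = partner s v then some (axis s v) else none := by
          funext w; rw [measuredString, if_pos h]
        rw [mirrorGate, dif_neg he, gate_two_toOp, e1, e2, pauliString_pair he,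
          pauliString_pair he, pairOp_conjTranspose, pairOp_mul he, pairOp_mul he,
          (exists_pair_basis_change (axis s v)).choose_spec.1]
  · set u := partner s v with hu
    have huv : partner s u = v := partner_partner s v
    have hne : u ≠ v := h.ne
    have hax : axis s u = axis s v := by rw [axis, hu, nodeDepth_partner, axis]
    refine gates_prod_conj (mirrorLayer n s).disjoint (mem u (by rw [huv]; exact h.le)) ?_ ?_ ?_
    · intro w hw
      rw [mirrorGate_support, huv] at hw
      simp only [Finset.mem_insert, Finset.mem_singleton, not_or] at hw
      rw [if_neg hw.2]
    · intro w hw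
      rw [mirrorGate_support, huv] at hw
      simp only [Finset.mem_insert, Finset.mem_singleton, not_or] at hw
      rw [measuredString, if_neg (not_le.mpr h), ← hu, if_neg hw.1, if_neg hw.2]
    · have e1 : (fun w => if w = v then some (2 : Fin 3) else none) =
          fun w => if w = u then none else if w = v then some 2 else none := by
        funext w
        by_cases hw : w = u
        · simp [hw, hne]
        · simp [hw]
      have e2 : measuredString s v = fun w => if w = u then some (axis s u + 1) else
          if w = v then some (axis s u + 2) else none := by
        funext w; rw [measuredString, if_neg (not_le.mpr h), ← hu, hax]
      have he : u ≠ partner s u := by rwa [huv]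
      rw [mirrorGate, dif_neg he, gate_two_toOp, huv, e1, e2, pauliString_pair hne,
        pauliString_pair hne, pairOp_conjTranspose, pairOp_mul hne, pairOp_mul hne,
        (exists_pair_basis_change (axis s u)).choose_spec.2]

/-! ### Commutation of Majorana pairs with the measured strings -/

/-- The sign by which two Pauli strings commute. -/
def stringSign {m : ℕ} (a b : Fin m → Option (Fin 3)) : ℂ := ∏ v, letterSign (a v) (b v)

theorem pauli_mul_comm (p q : Option (Fin 3)) :
    pauli p * pauli q = letterSign p q • (pauli q * pauli p) := by
  rcases p with _ | p
  · simp [letterSign, pauli]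
  rcases q with _ | q
  · simp [letterSign, pauli]
  ext i j
  fin_cases p <;> fin_cases q <;> fin_cases i <;> fin_cases j <;>
    simp [letterSign, pauli, Matrix.mul_apply, Fin.sum_univ_two]

theorem pauliString_mul_comm {m : ℕ} (a b : Fin m → Option (Fin 3)) :
    pauliString a * pauliString b = stringSign a b • (pauliString b * pauliString a) := by
  simp only [pauliString_eq_tensor, tensor_mul, stringSign]
  rw [← tensor_smul]
  exact congrArg tensor (funext fun v => pauli_mul_comm _ _)

theorem stringSign_mul_self {m : ℕ} (a b : Fin m → Option (Fin 3)) :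
    stringSign a b * stringSign a b = 1 := by
  rw [stringSign, ← Finset.prod_mul_distrib]
  refine Finset.prod_eq_one fun v _ => ?_
  rcases a v with _ | p
  · simp [letterSign]
  rcases b v with _ | q
  · simp [letterSign]
  by_cases h : p = q <;> simp [letterSign, h]

theorem commute_of_stringSign_eq {m : ℕ} {a b c : Fin m → Option (Fin 3)}
    (h : stringSign a c = stringSign b c) :
    Commute (pauliString a * pauliString b) (pauliString c) := by
  rw [Commute, SemiconjBy, Matrix.mul_assoc, pauliString_mul_comm b c, Matrix.mul_smul,
    ← Matrix.mul_assoc, pauliString_mul_comm a c, Matrix.smul_mul, smul_smul, h,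
    stringSign_mul_self, one_smul, Matrix.mul_assoc]

theorem stringSign_pair {m : ℕ} {i j : Fin m} (hij : i ≠ j) (a : Fin m → Option (Fin 3))
    (p q : Fin 3) :
    stringSign a (fun w => if w = i then some p else if w = j then some q else none) =
      letterSign (a i) (some p) * letterSign (a j) (some q) := by
  rw [stringSign, Fintype.prod_eq_mul i j hij]
  · simp [hij.symm]
  · rintro w ⟨h1, h2⟩
    rw [if_neg h1, if_neg h2, letterSign_none_right]

theorem stringSign_single {m : ℕ} (i : Fin m) (a : Fin m → Option (Fin 3)) (p : Fin 3) :
    stringSign a (fun w => if w = i then some p else none) = letterSign (a i) (some p) := by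
  rw [stringSign, Fintype.prod_eq_single i]
  · simp
  · intro w h1
    rw [if_neg h1, letterSign_none_right]

/-- The heart of the construction: mirror strings commute or anticommute alike with every measured
string, because the reflection exchanges the two letters of `P_q ⊗ P_{s - q}`. -/
theorem Mirrored.stringSign_eq {n : ℕ} {s : ℕ → Fin 3} {a b : ℕ → Option (Fin 3)}
    (h : Mirrored n s a b) (v : Fin n) :
    stringSign (fun w : Fin n => a w) (measuredString s v) =
      stringSign (fun w : Fin n => b w) (measuredString s v) := by
  have hpair : ∀ (i j : Fin n) (p q : Fin 3), i ≠ j → (j : ℕ) = reflect s i →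
      s (nodeDepth i) - p = q →
      stringSign (fun w : Fin n => a w)
          (fun w => if w = i then some p else if w = j then some q else none) =
        stringSign (fun w : Fin n => b w)
          (fun w => if w = i then some p else if w = j then some q else none) := by
    intro i j p q hij hj hq
    have hi : (i : ℕ) = reflect s j := by rw [hj, reflect_reflect]
    rw [stringSign_pair hij, stringSign_pair hij, h.map i i.2 (hj ▸ j.2),
      h.map j j.2 (hi ▸ i.2), ← hj, ← hi, letterSign_map_sub, letterSign_map_sub,
      hj, nodeDepth_reflect, ← hq, sub_sub_cancel, mul_comm]
  have haxis : ∀ t : Fin 3, t - -t = -t := by decide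
  have haxis' : ∀ t : Fin 3, t - (-t + 1) = -t + 2 := by decide
  by_cases he : partner s v = v
  · have e : measuredString s v = fun w => if w = v then some (axis s v) else none := by
      funext w
      rw [measuredString, if_pos he.ge, he]
      split_ifs <;> rfl
    rw [e, stringSign_single, stringSign_single]
    by_cases hr : reflect s v < n
    · have hv : reflect s v = v := by
        rw [partner, dif_pos hr] at he
        exact congrArg Fin.val he
      rw [h.map v v.2 hr, letterSign_map_sub, hv, axis, haxis]
    · exact h.sign v v.2 (not_lt.mp hr)
  · have hp := partner_val_of_ne he
    by_cases hle : v ≤ partner s v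
    · have e : measuredString s v = fun w => if w = v then some (axis s v) else
          if w = partner s v then some (axis s v) else none := by
        funext w; rw [measuredString, if_pos hle]
      rw [e]
      exact hpair _ _ _ _ (Ne.symm he) hp (haxis _)
    · have e : measuredString s v = fun w => if w = partner s v then some (axis s v + 1) else
          if w = v then some (axis s v + 2) else none := by
        funext w; rw [measuredString, if_neg hle]
      rw [e]
      exact hpair _ _ _ _ he (by rw [hp, reflect_reflect])
        (by rw [nodeDepth_partner]; exact haxis' _)

/-- An operator that commutes with all `Z_v` is diagonal. -/
theorem apply_eq_zero_of_commute {m : ℕ} {B : Op m}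
    (h : ∀ v, Commute B (pauliString fun w => if w = v then some 2 else none))
    {x y : Bits m} (hxy : x ≠ y) : B x y = 0 := by
  obtain ⟨v, hv⟩ := Function.ne_iff.mp hxy
  have hZ : (pauliString fun w => if w = v then some (2 : Fin 3) else none) =
      Matrix.diagonal fun x : Bits m => if x v = 0 then (1 : ℂ) else -1 := by
    ext x y
    rw [pauliString, Matrix.of_apply, Matrix.diagonal_apply]
    by_cases hxy : x = y
    · subst hxy
      rw [if_pos rfl, Fintype.prod_eq_single v]
      · rw [if_pos rfl]
        generalize x v = t
        fin_cases t <;> simp [pauli]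
      · intro w hw
        simp [hw, pauli]
    · obtain ⟨w, hw⟩ := Function.ne_iff.mp hxy
      rw [if_neg hxy]
      refine Finset.prod_eq_zero (Finset.mem_univ w) ?_
      by_cases hwv : w = v
      · rw [if_pos hwv]
        generalize x w = t at hw ⊢
        generalize y w = t' at hw ⊢
        fin_cases t <;> fin_cases t' <;> simp_all [pauli]
      · rw [if_neg hwv]
        simp [pauli, hw]
  have h1 := congrFun (congrFun (h v).eq x) y
  rw [hZ, Matrix.mul_diagonal, Matrix.diagonal_mul] at h1
  have hne : (if x v = 0 then (1 : ℂ) else -1) ≠ (if y v = 0 then (1 : ℂ) else -1) := by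
    generalize x v = t at hv ⊢
    generalize y v = t' at hv ⊢
    fin_cases t <;> fin_cases t' <;> simp_all <;> norm_num
  rw [mul_comm] at h1
  by_contra h0
  exact hne (mul_right_cancel₀ h0 h1).symm

/-! ### Concentration of empirical means -/

section Concentration

variable {Ω : Type*} [Fintype Ω] {q : Ω → ℝ}

theorem sum_prod_eq_one (hq1 : ∑ x, q x = 1) (N : ℕ) :
    ∑ data : Fin N → Ω, ∏ t, q (data t) = 1 := by
  rw [← Fintype.sum_pow, hq1, one_pow]

/-- A Bernstein-type moment bound: range and second moment at most `B` suffice. -/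
theorem sum_mul_exp_le (hq0 : ∀ x, 0 ≤ q x) (hq1 : ∑ x, q x = 1) {X : Ω → ℝ} {B c : ℝ}
    (hX : ∀ x, |X x| ≤ B) (hX2 : ∑ x, q x * X x ^ 2 ≤ B) (hc : 0 ≤ c) (hcB : c * B ≤ 1) :
    ∑ x, q x * Real.exp (c * X x) ≤ Real.exp (c * ∑ x, q x * X x + c ^ 2 * B) := by
  have h1 : ∀ x, Real.exp (c * X x) ≤ 1 + c * X x + c ^ 2 * X x ^ 2 := fun x => by
    have hle : |c * X x| ≤ 1 := by
      rw [abs_mul, abs_of_nonneg hc]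
      exact (mul_le_mul_of_nonneg_left (hX x) hc).trans hcB
    have := (abs_le.mp (Real.abs_exp_sub_one_sub_id_le hle)).2
    rw [mul_pow] at this
    linarith
  calc ∑ x, q x * Real.exp (c * X x)
      ≤ ∑ x, q x * (1 + c * X x + c ^ 2 * X x ^ 2) :=
        Finset.sum_le_sum fun x _ => mul_le_mul_of_nonneg_left (h1 x) (hq0 x)
    _ = 1 + c * ∑ x, q x * X x + c ^ 2 * ∑ x, q x * X x ^ 2 := by
        rw [Finset.mul_sum, Finset.mul_sum]
        conv_rhs => rw [← hq1]
        rw [← Finset.sum_add_distrib, ← Finset.sum_add_distrib]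
        exact Finset.sum_congr rfl fun x _ => by ring
    _ ≤ (c * ∑ x, q x * X x + c ^ 2 * B) + 1 := by
        have := mul_le_mul_of_nonneg_left hX2 (sq_nonneg c)
        linarith
    _ ≤ _ := Real.add_one_le_exp _

theorem tail_le (hq0 : ∀ x, 0 ≤ q x) (hq1 : ∑ x, q x = 1) {X : Ω → ℝ} {B ε : ℝ}
    (hB : 0 < B) (hX : ∀ x, |X x| ≤ B) (hX2 : ∑ x, q x * X x ^ 2 ≤ B) (hε : 0 ≤ ε)
    (hε2 : ε ≤ 2) (N : ℕ) :
    ∑ data : Fin N → Ω, Set.indicator {z : Fin N → Ω |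
      N * ε < ∑ t, X (z t) - N * ∑ x, q x * X x} (fun z => ∏ t, q (z t)) data ≤
      Real.exp (-(N * ε ^ 2 / (4 * B))) := by
  set μ := ∑ x, q x * X x with hμ
  -- the exponent that minimises the moment bound
  set c := ε / (2 * B) with hc
  have hc0 : 0 ≤ c := by positivity
  have hcB : c * B ≤ 1 := by
    rw [hc]; field_simp; linarith
  have hM := sum_mul_exp_le hq0 hq1 hX hX2 hc0 hcB
  rw [← hμ] at hM
  calc ∑ data : Fin N → Ω, Set.indicator {z : Fin N → Ω | N * ε < ∑ t, X (z t) - N * μ}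
          (fun z => ∏ t, q (z t)) data
      ≤ ∑ data : Fin N → Ω, ∏ t, (q (data t) * Real.exp (c * X (data t)) *
          Real.exp (-(c * (μ + ε)))) := by
        refine Finset.sum_le_sum fun z _ => ?_
        have hp : 0 ≤ ∏ t, q (z t) := Finset.prod_nonneg fun t _ => hq0 _
        rw [Finset.prod_mul_distrib, Finset.prod_mul_distrib, ← Real.exp_sum, ← Real.exp_sum,
          mul_assoc, ← Real.exp_add, ← Finset.mul_sum, Finset.sum_const, Finset.card_univ,
          Fintype.card_fin, nsmul_eq_mul]
        rw [Set.indicator_apply]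
        split_ifs with h
        · refine le_mul_of_one_le_right hp (Real.one_le_exp ?_)
          have h' : N * ε < ∑ t, X (z t) - N * μ := h
          have := mul_nonneg hc0 (sub_nonneg.mpr h'.le)
          linarith
        · positivity
    _ = (∑ x, q x * Real.exp (c * X x) * Real.exp (-(c * (μ + ε)))) ^ N :=
        (Fintype.sum_pow (fun x => q x * Real.exp (c * X x) * Real.exp (-(c * (μ + ε)))) N).symm
    _ ≤ Real.exp (-(ε ^ 2 / (4 * B))) ^ N := by
        refine pow_le_pow_left₀ (Finset.sum_nonneg fun x _ =>
          mul_nonneg (mul_nonneg (hq0 x) (Real.exp_nonneg _)) (Real.exp_nonneg _)) ?_ N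
        rw [← Finset.sum_mul]
        refine (mul_le_mul_of_nonneg_right hM (Real.exp_nonneg _)).trans (le_of_eq ?_)
        rw [← Real.exp_add]
        congr 1
        rw [hc]
        field_simp
        ring
    _ = Real.exp (-(N * ε ^ 2 / (4 * B))) := by
        rw [← Real.exp_nat_mul]
        congr 1
        ring

/-- Simultaneous estimation of finitely many real means by empirical means. -/
theorem one_sub_le_sum_indicator_real (hq0 : ∀ x, 0 ≤ q x) (hq1 : ∑ x, q x = 1) {ι : Type*}
    [Fintype ι] {X : ι → Ω → ℝ} {B ε : ℝ} (hB : 0 < B) (hX : ∀ k x, |X k x| ≤ B)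
    (hX2 : ∀ k, ∑ x, q x * X k x ^ 2 ≤ B) (hε : 0 ≤ ε) (hε2 : ε ≤ 2) (N : ℕ) :
    1 - 2 * Fintype.card ι * Real.exp (-(N * ε ^ 2 / (4 * B))) ≤
      ∑ data : Fin N → Ω, Set.indicator {z : Fin N → Ω |
        ∀ k, |∑ t, X k (z t) - N * ∑ x, q x * X k x| ≤ N * ε}
        (fun z => ∏ t, q (z t)) data := by
  set p : (Fin N → Ω) → ℝ := fun z => ∏ t, q (z t) with hp
  have hp0 : ∀ z, 0 ≤ p z := fun z => Finset.prod_nonneg fun t _ => hq0 _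
  let up : ι → Set (Fin N → Ω) := fun k =>
    {z | N * ε < ∑ t, X k (z t) - N * ∑ x, q x * X k x}
  let down : ι → Set (Fin N → Ω) := fun k =>
    {z | N * ε < ∑ t, -X k (z t) - N * ∑ x, q x * -X k x}
  have hup : ∀ k, ∑ z, (up k).indicator p z ≤ Real.exp (-(N * ε ^ 2 / (4 * B))) := fun k =>
    tail_le hq0 hq1 hB (hX k) (hX2 k) hε hε2 N
  have hdown : ∀ k, ∑ z, (down k).indicator p z ≤ Real.exp (-(N * ε ^ 2 / (4 * B))) := fun k =>
    tail_le (X := fun x => -X k x) hq0 hq1 hB (by simpa using hX k) (by simpa using hX2 k)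
      hε hε2 N
  set G : Set (Fin N → Ω) := {z | ∀ k, |∑ t, X k (z t) - N * ∑ x, q x * X k x| ≤ N * ε}
  have hcover : ∀ z, p z ≤ G.indicator p z +
      ∑ k, ((up k).indicator p z + (down k).indicator p z) := by
    intro z
    have hnn : ∀ k, 0 ≤ (up k).indicator p z + (down k).indicator p z := fun k =>
      add_nonneg (Set.indicator_nonneg (fun z _ => hp0 z) _)
        (Set.indicator_nonneg (fun z _ => hp0 z) _)
    by_cases hz : z ∈ G
    · rw [Set.indicator_of_mem hz]
      exact le_add_of_nonneg_right (Finset.sum_nonneg fun k _ => hnn k)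
    · rw [Set.indicator_of_notMem hz, zero_add]
      obtain ⟨k, hk⟩ := not_forall.mp hz
      refine le_trans ?_ (Finset.single_le_sum (fun k _ => hnn k) (Finset.mem_univ k))
      rw [not_le, lt_abs] at hk
      rcases hk with hk | hk
      · rw [Set.indicator_of_mem (show z ∈ up k from hk)]
        exact le_add_of_nonneg_right (Set.indicator_nonneg (fun z _ => hp0 z) _)
      · have : z ∈ down k := by
          simp only [down, Set.mem_ofPred_eq, mul_neg, Finset.sum_neg_distrib]
          linarith
        rw [Set.indicator_of_mem this]
        exact le_add_of_nonneg_left (Set.indicator_nonneg (fun z _ => hp0 z) _)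
  have hsum := Finset.sum_le_sum fun z (_ : z ∈ Finset.univ) => hcover z
  rw [sum_prod_eq_one hq1, Finset.sum_add_distrib, Finset.sum_comm] at hsum
  have hbad : ∑ k, ∑ z, ((up k).indicator p z + (down k).indicator p z) ≤
      ∑ _k : ι, 2 * Real.exp (-(N * ε ^ 2 / (4 * B))) := by
    refine Finset.sum_le_sum fun k _ => ?_
    rw [Finset.sum_add_distrib]
    linarith [hup k, hdown k]
  rw [Finset.sum_const, Finset.card_univ, nsmul_eq_mul] at hbad
  linarith

/-- Simultaneous estimation of finitely many complex means by empirical means. -/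
theorem one_sub_le_sum_indicator (hq0 : ∀ x, 0 ≤ q x) (hq1 : ∑ x, q x = 1) {ι : Type*}
    [Fintype ι] {X : ι → Ω → ℂ} {μ : ι → ℂ} {B ε : ℝ} (hB : 0 < B) (hX : ∀ k x, ‖X k x‖ ≤ B)
    (hX2 : ∀ k, ∑ x, q x * ‖X k x‖ ^ 2 ≤ B) (hμ : ∀ k, ∑ x, (q x : ℂ) * X k x = μ k)
    (hε : 0 ≤ ε) (hε2 : ε ≤ 4) {N : ℕ} (hN : 0 < N) :
    1 - 4 * Fintype.card ι * Real.exp (-(N * ε ^ 2 / (16 * B))) ≤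
      ∑ data : Fin N → Ω, Set.indicator {z : Fin N → Ω |
        ∀ k, ‖(N : ℂ)⁻¹ * ∑ t, X k (z t) - μ k‖ ≤ ε} (fun z => ∏ t, q (z t)) data := by
  let Y : ι × Bool → Ω → ℝ := fun k x => if k.2 then (X k.1 x).re else (X k.1 x).im
  have hYX : ∀ k x, |Y k x| ≤ ‖X k.1 x‖ := fun k x => by
    simp only [Y]
    split_ifs
    · exact Complex.abs_re_le_norm _
    · exact Complex.abs_im_le_norm _
  have h := one_sub_le_sum_indicator_real (X := Y) hq0 hq1 hB
    (fun k x => (hYX k x).trans (hX _ _))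
    (fun k => (Finset.sum_le_sum fun x _ => mul_le_mul_of_nonneg_left
      (sq_le_sq' ((neg_le_neg (hYX k x)).trans (abs_le.mp le_rfl).1)
        ((le_abs_self _).trans (hYX k x))) (hq0 x)).trans (hX2 k.1))
    (by positivity : 0 ≤ ε / 2) (by linarith) N
  rw [Fintype.card_prod, Fintype.card_bool] at h
  refine le_trans (le_of_eq ?_) (h.trans (Finset.sum_le_sum fun z _ =>
    Set.indicator_le_indicator_of_subset ?_ (fun z => Finset.prod_nonneg fun t _ => hq0 _) z))
  · rw [show (N : ℝ) * (ε / 2) ^ 2 / (4 * B) = N * ε ^ 2 / (16 * B) by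
      field_simp; ring]
    push_cast
    ring
  · intro z hz k
    have hN' : (0 : ℝ) < N := Nat.cast_pos.mpr hN
    set w : ℂ := ∑ t, X k (z t) - N * μ k with hw
    have hre : |w.re| ≤ N * (ε / 2) := by
      have := hz (k, true)
      rw [hw, ← hμ k]
      simpa [Y] using this
    have him : |w.im| ≤ N * (ε / 2) := by
      have := hz (k, false)
      rw [hw, ← hμ k]
      simpa [Y] using this
    have e : (N : ℂ)⁻¹ * ∑ t, X k (z t) - μ k = (N : ℂ)⁻¹ * w := by
      rw [hw, mul_sub, inv_mul_cancel_left₀ (Nat.cast_ne_zero.mpr hN.ne')]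
    rw [e, norm_mul, norm_inv, Complex.norm_natCast, inv_mul_le_iff₀ hN']
    linarith [Complex.norm_le_abs_re_add_abs_im w]

end Concentration

/-! ### Generating the random reflection -/

theorem prod_one_qubit_gates {m : ℕ} (U : Matrix.unitaryGroup (Fin 2) ℂ) {l : List (Fin m)}
    (hl : l.Nodup) : ((l.map fun i => Gate.one i U).map Gate.toOp).prod =
      tensor (fun v => if v ∈ l then (U : Matrix (Fin 2) (Fin 2) ℂ) else 1) := by
  induction l with
  | nil => simp [tensor_one]
  | cons i l ih =>
    obtain ⟨hi, hl⟩ := List.nodup_cons.mp hl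
    rw [List.map_cons, List.map_cons, List.prod_cons, ih hl, gate_one_toOp, tensor_mul]
    congr 1
    funext v
    by_cases h : v = i
    · simp [h, hi]
    · simp [h]

/-- A layer of one-qubit gates that turns `|0…0⟩` into a state with uniform outcomes. -/
def uniformLayer (m : ℕ) : Layer m where
  gates := (List.finRange m).map fun i => Gate.one i ⟨cyclicRotation, cyclicRotation_mem⟩
  disjoint := by
    rw [List.pairwise_map]
    exact (List.nodup_finRange m).imp fun h => by simpa [Gate.support] using h

theorem norm_uniformLayer_sq (m : ℕ) (x : Bits m) :
    ‖(uniformLayer m).toOp x 0‖ ^ 2 = (1 / 2) ^ m := by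
  have hentry : ∀ t : Fin 2, ‖cyclicRotation t 0‖ ^ 2 = 1 / 2 := by
    intro t
    rw [← Complex.normSq_eq_norm_sq]
    fin_cases t <;> simp [cyclicRotation, Complex.normSq_apply] <;> norm_num
  rw [Layer.toOp, uniformLayer, prod_one_qubit_gates _ (List.nodup_finRange m)]
  simp only [tensor, Matrix.of_apply, List.mem_finRange, if_true, norm_prod, Pi.zero_apply,
    ← Finset.prod_pow, hentry]
  simp

/-- A map between finite types whose fibres all have at least half the average size. -/
theorem exists_balanced_map (α β : Type*) [Fintype α] [Fintype β] [DecidableEq β] [Nonempty β]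
    (h : Fintype.card β ≤ Fintype.card α) : ∃ g : α → β, ∀ b,
      Fintype.card α ≤ 2 * Fintype.card β * (Finset.univ.filter fun a => g a = b).card := by
  set k := Fintype.card α / Fintype.card β with hk
  have hβ : 0 < Fintype.card β := Fintype.card_pos
  have hk1 : 1 ≤ k := (Nat.one_le_div_iff hβ).mpr h
  have hcard : Fintype.card (β × Fin k) ≤ Fintype.card α := by
    rw [Fintype.card_prod, Fintype.card_fin]
    exact Nat.mul_div_le _ _
  obtain ⟨e⟩ := Function.Embedding.nonempty_of_card_le hcard
  have : Nonempty (β × Fin k) := ⟨(Classical.arbitrary β, ⟨0, hk1⟩)⟩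
  refine ⟨fun a => (Function.invFun e a).1, fun b => ?_⟩
  have hfib : k ≤ (Finset.univ.filter fun a => (Function.invFun e a).1 = b).card := by
    have := Finset.card_le_card_of_injOn (s := (Finset.univ : Finset (Fin k)))
      (t := Finset.univ.filter fun a => (Function.invFun e a).1 = b) (fun i => e (b, i))
      (fun i _ => by simp [Function.leftInverse_invFun e.injective (b, i)])
      (fun i _ j _ hij => (Prod.ext_iff.mp (e.injective hij)).2)
    simpa using this
  have hlt : Fintype.card α < Fintype.card β * (k + 1) := Nat.lt_mul_div_succ _ hβ
  nlinarith

/-- The reflections needed for `n` qubits, one letter for every level of the tree. -/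
abbrev Axes (n : ℕ) : Type := Fin (Nat.clog 3 (2 * n + 1)) → Fin 3

/-- The letters of a reflection, extended by zero beyond the levels of the tree. -/
def Axes.extend {n : ℕ} (s : Axes n) (j : ℕ) : Fin 3 :=
  if h : j < Nat.clog 3 (2 * n + 1) then s ⟨j, h⟩ else 0

theorem card_axes_lt {n : ℕ} (hn : 2 ≤ n) : Fintype.card (Axes n) < 3 * (2 * n + 1) := by
  rw [Fintype.card_fun, Fintype.card_fin, Fintype.card_fin]
  have h1 : 3 ^ (Nat.clog 3 (2 * n + 1)).pred < 2 * n + 1 :=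
    Nat.pow_pred_clog_lt_self (by norm_num) (by omega)
  have h2 : 0 < Nat.clog 3 (2 * n + 1) := Nat.clog_pos (by norm_num) (by omega)
  obtain ⟨k, hk⟩ : ∃ k, Nat.clog 3 (2 * n + 1) = k + 1 := ⟨_, (Nat.succ_pred_eq_of_pos h2).symm⟩
  rw [hk, Nat.pred_succ] at h1
  rw [hk, pow_succ]
  omega

theorem exists_balanced_axes {n : ℕ} (hn : 2 ≤ n) : ∃ g : Bits (2 * n) → Axes n, ∀ s,
    (2 : ℝ) ^ (2 * n) ≤ 15 * n * (Finset.univ.filter fun r => g r = s).card := by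
  have hcard := card_axes_lt hn
  have hpow : 3 * (2 * n + 1) ≤ 4 ^ n := by
    induction n, hn using Nat.le_induction with
    | base => norm_num
    | succ k hk ih => rw [pow_succ]; have := ih (card_axes_lt hk); omega
  have hbits : Fintype.card (Bits (2 * n)) = 4 ^ n := by
    rw [Fintype.card_fun, Fintype.card_fin, Fintype.card_fin, pow_mul]; norm_num
  obtain ⟨g, hg⟩ := exists_balanced_map (Bits (2 * n)) (Axes n) (by omega)
  refine ⟨g, fun s => ?_⟩
  have h1 := hg s
  rw [hbits] at h1
  have h2 : 4 ^ n ≤ 15 * n * (Finset.univ.filter fun r => g r = s).card :=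
    h1.trans (Nat.mul_le_mul_right _ (by omega))
  rw [pow_mul]
  norm_num
  exact_mod_cast h2

/-! ### The dynamic circuit and its estimators -/

/-- Uniformly random bits select a reflection through `g`; the feedback layer measures the pairs
of nodes that it exchanges. -/
def mirrorCircuit {n : ℕ} (g : Bits (2 * n) → Axes n) : DynamicCircuit n where
  reg := 2 * n
  gen := [uniformLayer (2 * n)]
  feedback r := [mirrorLayer n (g r).extend]

/-- The unitary that is applied before the qubits are read out, for the reflection `s`. -/
def mirrorOp {n : ℕ} (s : Axes n) : Op n := (mirrorLayer n s.extend).toOp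

theorem mirrorOp_isometry {n : ℕ} (s : Axes n) : (mirrorOp s)ᴴ * mirrorOp s = 1 :=
  gates_prod_isometry _

theorem mirrorOp_coisometry {n : ℕ} (s : Axes n) : mirrorOp s * (mirrorOp s)ᴴ = 1 :=
  mul_eq_one_comm.mp (mirrorOp_isometry s)

theorem mirrorCircuit_measuresPaulis {n : ℕ} (g : Bits (2 * n) → Axes n) :
    (mirrorCircuit g).MeasuresPaulis := fun r v => by
  refine ⟨measuredString (g r).extend v, 1, ?_⟩
  simp only [mirrorCircuit, circuitOp, Matrix.one_mul, mirrorLayer_conj]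
  simp

/-- The Born probability of a record of the mirror circuit. -/
def mirrorProb {n : ℕ} (g : Bits (2 * n) → Axes n) (ρ : Op n) (x : Bits (2 * n) × Bits n) : ℝ :=
  (mirrorCircuit g).recordProb ρ x

theorem mirrorProb_eq {n : ℕ} (g : Bits (2 * n) → Axes n) (ρ : Op n)
    (x : Bits (2 * n) × Bits n) : mirrorProb g ρ x =
      (1 / 2) ^ (2 * n) * ((mirrorOp (g x.1) * ρ * (mirrorOp (g x.1))ᴴ) x.2 x.2).re := by
  rw [← norm_uniformLayer_sq (2 * n) x.1]
  simp only [mirrorProb, DynamicCircuit.recordProb, mirrorCircuit, circuitOp, Matrix.one_mul,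
    mirrorOp]
  rfl

theorem mirrorOp_conj_posSemidef {n : ℕ} (s : Axes n) {ρ : Op n} (hρ : IsState ρ) :
    (mirrorOp s * ρ * (mirrorOp s)ᴴ).PosSemidef := hρ.1.mul_mul_conjTranspose_same _

theorem mirrorProb_nonneg {n : ℕ} (g : Bits (2 * n) → Axes n) {ρ : Op n} (hρ : IsState ρ)
    (x : Bits (2 * n) × Bits n) : 0 ≤ mirrorProb g ρ x := by
  rw [mirrorProb_eq]
  refine mul_nonneg (by positivity) ?_
  exact (Complex.le_def.mp ((mirrorOp_conj_posSemidef (g x.1) hρ).diag_nonneg (i := x.2))).1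

theorem ofReal_mirrorProb {n : ℕ} (g : Bits (2 * n) → Axes n) {ρ : Op n} (hρ : IsState ρ)
    (x : Bits (2 * n) × Bits n) : ((mirrorProb g ρ x : ℝ) : ℂ) =
      (1 / 2) ^ (2 * n) * (mirrorOp (g x.1) * ρ * (mirrorOp (g x.1))ᴴ) x.2 x.2 := by
  rw [mirrorProb_eq]
  push_cast
  congr 1
  exact Complex.ext rfl
    (Complex.le_def.mp ((mirrorOp_conj_posSemidef (g x.1) hρ).diag_nonneg (i := x.2))).2

/-- Given the message, the readout of a state has total probability one. -/
theorem sum_mirrorOp_conj_diag {n : ℕ} (s : Axes n) {ρ : Op n} (hρ : IsState ρ) :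
    ∑ z, (mirrorOp s * ρ * (mirrorOp s)ᴴ) z z = 1 := by
  have : (mirrorOp s * ρ * (mirrorOp s)ᴴ).trace = 1 := by
    rw [Matrix.trace_mul_comm, ← Matrix.mul_assoc, mirrorOp_isometry, Matrix.one_mul, hρ.2]
  exact this

theorem sum_mirrorProb_readout {n : ℕ} (g : Bits (2 * n) → Axes n) {ρ : Op n} (hρ : IsState ρ)
    (r : Bits (2 * n)) : ∑ z, mirrorProb g ρ (r, z) = (1 / 2) ^ (2 * n) := by
  have h : ((∑ z, mirrorProb g ρ (r, z) : ℝ) : ℂ) = (1 / 2) ^ (2 * n) := by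
    push_cast
    simp only [ofReal_mirrorProb g hρ]
    rw [← Finset.mul_sum, sum_mirrorOp_conj_diag _ hρ, mul_one]
  apply Complex.ofReal_injective
  rw [h]
  push_cast
  rfl

theorem sum_mirrorProb {n : ℕ} (g : Bits (2 * n) → Axes n) {ρ : Op n} (hρ : IsState ρ) :
    ∑ x : Bits (2 * n) × Bits n, mirrorProb g ρ x = 1 := by
  rw [Fintype.sum_prod_type]
  simp only [sum_mirrorProb_readout g hρ]
  simp

theorem pauliString_conjTranspose {m : ℕ} (s : Fin m → Option (Fin 3)) :
    (pauliString s)ᴴ = pauliString s := by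
  rw [pauliString_eq_tensor, tensor_conjTranspose]
  congr 1
  funext v
  rcases s v with _ | p
  · exact conjTranspose_one
  · ext i j
    fin_cases p <;> fin_cases i <;> fin_cases j <;> simp [pauli]

theorem pauliString_mul_self {m : ℕ} (s : Fin m → Option (Fin 3)) :
    pauliString s * pauliString s = 1 := by
  rw [pauliString_eq_tensor, tensor_mul, ← tensor_one]
  congr 1
  funext v
  rcases s v with _ | p
  · exact Matrix.one_mul 1
  · ext i j
    fin_cases p <;> fin_cases i <;> fin_cases j <;>
      simp [pauli, Matrix.mul_apply, Fin.sum_univ_two]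

theorem exists_axes_mirrored {n : ℕ} (k : Fin (2 * n + 1) × Fin (2 * n + 1)) :
    ∃ s : Axes n, Mirrored n s.extend (pathLetter (n + k.1)) (pathLetter (n + k.2)) := by
  obtain ⟨s, h0, hs⟩ := exists_mirrored (n := n) (p := n + k.1) (q := n + k.2)
    (by omega) (by omega) (by omega) (by omega)
  refine ⟨fun j => s j, ?_⟩
  convert hs
  funext j
  unfold Axes.extend
  split_ifs with h
  · rfl
  · exact (h0 j (not_lt.mp h)).symm

/-- A reflection that exchanges two given leaves. -/
def pairAxes {n : ℕ} (k : Fin (2 * n + 1) × Fin (2 * n + 1)) : Axes n :=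
  (exists_axes_mirrored k).choose

/-- The product of two Majorana operators, seen in the basis in which it is read out. -/
def pairReadout {n : ℕ} (k : Fin (2 * n + 1) × Fin (2 * n + 1)) : Op n :=
  mirrorOp (pairAxes k) * (treeMajorana n k.1 * treeMajorana n k.2) * (mirrorOp (pairAxes k))ᴴ

theorem pairReadout_apply_of_ne {n : ℕ} (k : Fin (2 * n + 1) × Fin (2 * n + 1)) {x y : Bits n}
    (hxy : x ≠ y) : pairReadout k x y = 0 := by
  refine apply_eq_zero_of_commute (fun v => ?_) hxy
  have hc : Commute (treeMajorana n k.1 * treeMajorana n k.2)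
      (pauliString (measuredString (pairAxes k).extend v)) :=
    commute_of_stringSign_eq ((exists_axes_mirrored k).choose_spec.stringSign_eq v)
  rw [← mirrorLayer_conj] at hc
  set F := mirrorOp (pairAxes k) with hF
  set A := treeMajorana n k.1 * treeMajorana n k.2
  set Z : Op n := pauliString fun w => if w = v then some 2 else none
  have hFF : F * Fᴴ = 1 := mirrorOp_coisometry _
  have hc' : A * (Fᴴ * Z * F) = Fᴴ * Z * F * A := hc
  change F * A * Fᴴ * Z = Z * (F * A * Fᴴ)
  calc F * A * Fᴴ * Z = F * (A * (Fᴴ * Z * F)) * Fᴴ := by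
        simp only [Matrix.mul_assoc, hFF, Matrix.mul_one]
    _ = (F * Fᴴ) * Z * (F * A * Fᴴ) := by rw [hc']; simp only [Matrix.mul_assoc]
    _ = Z * (F * A * Fᴴ) := by rw [hFF, Matrix.one_mul]

theorem norm_pairReadout_le {n : ℕ} (k : Fin (2 * n + 1) × Fin (2 * n + 1)) (x y : Bits n) :
    ‖pairReadout k x y‖ ≤ 1 := by
  refine entry_norm_bound_of_unitary ?_ x y
  have hF : mirrorOp (pairAxes k) ∈ Matrix.unitaryGroup (Bits n) ℂ :=
    Matrix.mem_unitaryGroup_iff'.mpr (mirrorOp_isometry _)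
  have hP : ∀ l, treeMajorana n l ∈ Matrix.unitaryGroup (Bits n) ℂ := fun l => by
    rw [Matrix.mem_unitaryGroup_iff, Matrix.star_eq_conjTranspose, treeMajorana,
      pauliString_conjTranspose, pauliString_mul_self]
  exact mul_mem (mul_mem hF (mul_mem (hP _) (hP _))) (Unitary.star_mem hF)

/-- The single-run estimator of a product of two Majorana operators: the diagonal entry at the
observed bits, weighted by the inverse probability of the reflection that makes it visible. -/
def pairEstimator {n : ℕ} (g : Bits (2 * n) → Axes n) (k : Fin (2 * n + 1) × Fin (2 * n + 1))
    (x : Bits (2 * n) × Bits n) : ℂ :=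
  if g x.1 = pairAxes k then
    (2 : ℂ) ^ (2 * n) / ((Finset.univ.filter fun r => g r = pairAxes k).card : ℂ) *
      pairReadout k x.2 x.2
  else 0

theorem sum_mirrorProb_mul_pairEstimator {n : ℕ} {g : Bits (2 * n) → Axes n}
    {ρ : Op n} (hρ : IsState ρ) (k : Fin (2 * n + 1) × Fin (2 * n + 1))
    (hg : (Finset.univ.filter fun r => g r = pairAxes k).card ≠ 0) :
    ∑ x : Bits (2 * n) × Bits n, (mirrorProb g ρ x : ℂ) * pairEstimator g k x =
      (ρ * (treeMajorana n k.1 * treeMajorana n k.2)).trace := by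
  set M := (Finset.univ.filter fun r => g r = pairAxes k).card with hM
  set F := mirrorOp (pairAxes k) with hF
  have htrace : ∑ z, (F * ρ * Fᴴ) z z * pairReadout k z z =
      (ρ * (treeMajorana n k.1 * treeMajorana n k.2)).trace := by
    have h1 : ∑ z, (F * ρ * Fᴴ) z z * pairReadout k z z = (F * ρ * Fᴴ * pairReadout k).trace := by
      rw [Matrix.trace]
      refine Finset.sum_congr rfl fun z _ => ?_
      rw [Matrix.diag_apply, Matrix.mul_apply (M := F * ρ * Fᴴ), Finset.sum_eq_single z]
      · intro y _ hy
        rw [pairReadout_apply_of_ne k hy, mul_zero]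
      · simp
    have hFF : Fᴴ * F = 1 := mirrorOp_isometry _
    have hFF' : ∀ A, Fᴴ * (F * A) = A := fun A => by rw [← Matrix.mul_assoc, hFF, Matrix.one_mul]
    rw [h1, pairReadout, ← hF, ← Matrix.mul_assoc _ _ Fᴴ, Matrix.trace_mul_comm]
    simp only [Matrix.mul_assoc, hFF']
  have hr : ∀ r, ∑ z, (mirrorProb g ρ (r, z) : ℂ) * pairEstimator g k (r, z) =
      if g r = pairAxes k then
        (M : ℂ)⁻¹ * (ρ * (treeMajorana n k.1 * treeMajorana n k.2)).trace else 0 := by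
    intro r
    simp only [ofReal_mirrorProb g hρ, pairEstimator]
    split_ifs with h
    · rw [h, ← htrace, Finset.mul_sum, ← hM]
      refine Finset.sum_congr rfl fun z _ => ?_
      have : ((1 / 2 : ℂ)) ^ (2 * n) * 2 ^ (2 * n) = 1 := by
        rw [← mul_pow]; norm_num
      linear_combination ((M : ℂ)⁻¹ * (F * ρ * Fᴴ) z z * pairReadout k z z) * this
    · simp
  rw [Fintype.sum_prod_type]
  simp only [hr]
  rw [← Finset.sum_filter, Finset.sum_const, ← hM, nsmul_eq_mul,
    mul_inv_cancel_left₀ (Nat.cast_ne_zero.mpr hg)]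

theorem norm_pairEstimator_le {n : ℕ} {g : Bits (2 * n) → Axes n}
    (k : Fin (2 * n + 1) × Fin (2 * n + 1)) (x : Bits (2 * n) × Bits n) :
    ‖pairEstimator g k x‖ ≤ if g x.1 = pairAxes k then
      (2 : ℝ) ^ (2 * n) / ((Finset.univ.filter fun r => g r = pairAxes k).card : ℝ) else 0 := by
  unfold pairEstimator
  split_ifs
  · rw [norm_mul]
    refine (mul_le_of_le_one_right (norm_nonneg _) (norm_pairReadout_le k _ _)).trans ?_
    simp
  · simp

theorem sum_mirrorProb_mul_norm_sq_le {n : ℕ} {g : Bits (2 * n) → Axes n}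
    {ρ : Op n} (hρ : IsState ρ) (k : Fin (2 * n + 1) × Fin (2 * n + 1)) :
    ∑ x : Bits (2 * n) × Bits n, mirrorProb g ρ x * ‖pairEstimator g k x‖ ^ 2 ≤
      (2 : ℝ) ^ (2 * n) / ((Finset.univ.filter fun r => g r = pairAxes k).card : ℝ) := by
  set M := (Finset.univ.filter fun r => g r = pairAxes k).card with hM
  set a : ℝ := (2 : ℝ) ^ (2 * n) / (M : ℝ) with ha
  have ha0 : 0 ≤ a := by positivity
  calc ∑ x : Bits (2 * n) × Bits n, mirrorProb g ρ x * ‖pairEstimator g k x‖ ^ 2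
      ≤ ∑ x : Bits (2 * n) × Bits n, mirrorProb g ρ x *
          (if g x.1 = pairAxes k then a ^ 2 else 0) := by
        refine Finset.sum_le_sum fun x _ =>
          mul_le_mul_of_nonneg_left ?_ (mirrorProb_nonneg g hρ x)
        have h := pow_le_pow_left₀ (norm_nonneg _) (norm_pairEstimator_le (g := g) k x) 2
        refine h.trans (le_of_eq ?_)
        split_ifs <;> simp [ha, hM]
    _ = ∑ r : Bits (2 * n), if g r = pairAxes k then (1 / 2 : ℝ) ^ (2 * n) * a ^ 2 else 0 := by
        rw [Fintype.sum_prod_type]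
        refine Finset.sum_congr rfl fun r _ => ?_
        change ∑ z, mirrorProb g ρ (r, z) * (if g r = pairAxes k then a ^ 2 else 0) = _
        rw [← Finset.sum_mul, sum_mirrorProb_readout g hρ]
        split_ifs <;> simp
    _ = M * ((1 / 2 : ℝ) ^ (2 * n) * a ^ 2) := by
        rw [← Finset.sum_filter, Finset.sum_const, ← hM, nsmul_eq_mul]
    _ ≤ a := by
        rcases Nat.eq_zero_or_pos M with h | h
        · rw [h, Nat.cast_zero, zero_mul]; exact ha0
        · have hM' : (M : ℝ) ≠ 0 := Nat.cast_ne_zero.mpr h.ne'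
          have h2 : ((1 / 2 : ℝ)) ^ (2 * n) * 2 ^ (2 * n) = 1 := by
            rw [← mul_pow]; norm_num
          have h3 : (M : ℝ) * a = 2 ^ (2 * n) := mul_div_cancel₀ _ hM'
          refine le_of_eq ?_
          calc (M : ℝ) * ((1 / 2 : ℝ) ^ (2 * n) * a ^ 2)
              = (1 / 2 : ℝ) ^ (2 * n) * (M * a) * a := by ring
            _ = a := by rw [h3, h2, one_mul]

/-- The four Majorana products in `c i† c j`. -/
theorem trace_mul_oneBody {n : ℕ} (leaf : Fin n × Fin 2 ↪ Fin (2 * n + 1)) (ρ : Op n)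
    (i j : Fin n) : (ρ * oneBody leaf i j).trace = (1 / 4 : ℂ) *
      ((ρ * (treeMajorana n (leaf (i, 0)) * treeMajorana n (leaf (j, 0)))).trace +
        Complex.I * (ρ * (treeMajorana n (leaf (i, 0)) * treeMajorana n (leaf (j, 1)))).trace -
        Complex.I * (ρ * (treeMajorana n (leaf (i, 1)) * treeMajorana n (leaf (j, 0)))).trace +
        (ρ * (treeMajorana n (leaf (i, 1)) * treeMajorana n (leaf (j, 1)))).trace) := by
  have hI := Complex.I_mul_I
  simp only [oneBody, annihilation, conjTranspose_smul, conjTranspose_add, treeMajorana,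
    pauliString_conjTranspose, Matrix.mul_add, Matrix.add_mul, Matrix.smul_mul, Matrix.mul_smul,
    Matrix.trace_add, Matrix.trace_smul, smul_eq_mul, smul_add]
  simp only [star_div₀, star_one, Complex.star_def, Complex.conj_I, conj_two]
  linear_combination (-(1 / 4 : ℂ) * (ρ * (pauliString (leafString n (leaf (i, 1))) *
    pauliString (leafString n (leaf (j, 1))))).trace) * hI

theorem norm_quarter_sum_le {a b c d : ℂ} {ε : ℝ} (ha : ‖a‖ ≤ ε) (hb : ‖b‖ ≤ ε) (hc : ‖c‖ ≤ ε)
    (hd : ‖d‖ ≤ ε) : ‖(1 / 4 : ℂ) * (a + Complex.I * b - Complex.I * c + d)‖ ≤ ε := by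
  have h1 := norm_add_le (a + Complex.I * b - Complex.I * c) d
  have h2 := norm_sub_le (a + Complex.I * b) (Complex.I * c)
  have h3 := norm_add_le a (Complex.I * b)
  rw [norm_mul, Complex.norm_I, one_mul] at h2 h3
  rw [norm_mul]
  norm_num
  linarith

/-- The number of runs: large enough for the union bound over `4 (2 n + 1) ^ 2` tail events. -/
theorem exists_sample_size {n : ℕ} (hn : 2 ≤ n) {ε δ : ℝ} (hε : 0 < ε)
    (hnε : (n : ℝ) ≤ 1 / ε ^ 2) (hδ : 0 < δ) (hδ1 : δ < 1) :
    ∃ N : ℕ, 0 < N ∧ (N : ℝ) ≤ 1681 * ((n : ℝ) * Real.log ((n : ℝ) / δ) / ε ^ 2) ∧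
      4 * ((2 * n + 1 : ℝ) * (2 * n + 1)) * Real.exp (-(N * ε ^ 2 / (16 * (15 * n)))) ≤ δ := by
  have hn' : (2 : ℝ) ≤ n := by exact_mod_cast hn
  set L := Real.log ((n : ℝ) / δ) with hL
  set T := 4 * ((2 * n + 1 : ℝ) * (2 * n + 1)) / δ with hT
  have hnδ : 2 ≤ (n : ℝ) / δ := by
    rw [le_div_iff₀ hδ]; nlinarith
  have hL2 : 1 / 2 ≤ L := by
    have h1 : Real.log 2 ≤ L := Real.log_le_log (by norm_num) hnδ
    linarith [Real.log_two_gt_d9]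
  have hT1 : 1 < T := by
    rw [hT, lt_div_iff₀ hδ]; nlinarith
  have hlogT0 : 0 < Real.log T := Real.log_pos hT1
  -- `4 (2 n + 1) ^ 2 ≤ 25 n ^ 2 ≤ n ^ 7`
  have hTle : T ≤ ((n : ℝ) / δ) ^ 7 := by
    have h5 : (32 : ℝ) ≤ (n : ℝ) ^ 5 := by
      calc (32 : ℝ) = 2 ^ 5 := by norm_num
        _ ≤ _ := pow_le_pow_left₀ (by norm_num) hn' 5
    have h7 : 4 * ((2 * n + 1 : ℝ) * (2 * n + 1)) ≤ (n : ℝ) ^ 7 := by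
      have : (n : ℝ) ^ 7 = n ^ 5 * n ^ 2 := by ring
      nlinarith [mul_le_mul_of_nonneg_right h5 (sq_nonneg (n : ℝ))]
    have hδ7 : δ ^ 7 ≤ δ := pow_le_of_le_one hδ.le hδ1.le (by norm_num)
    rw [hT, div_pow]
    exact div_le_div₀ (by positivity) h7 (by positivity) hδ7
  have hlogT : Real.log T ≤ 7 * L := by
    have := Real.log_le_log (by linarith) hTle
    rw [Real.log_pow] at this
    exact_mod_cast this
  have hε2 : 0 < ε ^ 2 := by positivity
  set R := 240 * n / ε ^ 2 * Real.log T with hR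
  have hR0 : 0 < R := by positivity
  refine ⟨⌈R⌉₊, Nat.ceil_pos.mpr hR0, ?_, ?_⟩
  · have h1 : (⌈R⌉₊ : ℝ) ≤ R + 1 := (Nat.ceil_lt_add_one hR0.le).le
    have hE : 2 ≤ 1 / ε ^ 2 := hn'.trans hnε
    have h2 : 1 ≤ (n : ℝ) * L / ε ^ 2 := by
      have h3 : 1 ≤ (n : ℝ) * L := by nlinarith
      rw [mul_div_assoc, div_eq_mul_one_div, ← mul_assoc]
      nlinarith
    have h4 : R ≤ 1680 * ((n : ℝ) * L / ε ^ 2) := by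
      calc R ≤ 240 * n / ε ^ 2 * (7 * L) :=
            mul_le_mul_of_nonneg_left hlogT (by positivity)
        _ = _ := by ring
    linarith
  · have h1 : Real.log T ≤ ⌈R⌉₊ * ε ^ 2 / (16 * (15 * n)) := by
      rw [le_div_iff₀ (by positivity)]
      calc Real.log T * (16 * (15 * n)) = R * ε ^ 2 := by rw [hR]; field_simp; ring
        _ ≤ _ := mul_le_mul_of_nonneg_right (Nat.le_ceil R) hε2.le
    have h2 : Real.exp (-(⌈R⌉₊ * ε ^ 2 / (16 * (15 * n)))) ≤ T⁻¹ := by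
      rw [← Real.exp_log (by linarith : 0 < T), ← Real.exp_neg]
      exact Real.exp_le_exp.mpr (neg_le_neg (by simpa using h1))
    refine (mul_le_mul_of_nonneg_left h2 (by positivity)).trans (le_of_eq ?_)
    rw [hT]
    field_simp

end FermionShadow

end

theorem mainTheorem5 :
    ∃ (C : ℝ) (d : ℕ), 0 < C ∧ ∀ n : ℕ, 2 ≤ n →
      (∀ k : Fin (2 * n + 1),
        FermionShadow.weight (FermionShadow.leafString n k) ≤ Nat.clog 3 (2 * n + 1)) ∧
      ∃ D : FermionShadow.DynamicCircuit n, D.reg ≤ 2 * n ∧ D.DepthLE d ∧ D.MeasuresPaulis ∧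
        ∀ (leaf : Fin n × Fin 2 ↪ Fin (2 * n + 1)) (ε δ : ℝ),
          0 < ε → (n : ℝ) ≤ 1 / ε ^ 2 → 0 < δ → δ < 1 →
          ∃ N : ℕ, (N : ℝ) ≤ C * ((n : ℝ) * Real.log ((n : ℝ) / δ) / ε ^ 2) ∧
            ∃ est : (Fin N → D.Record) → Fin n → Fin n → ℂ,
              ∀ ρ : FermionShadow.Op n, FermionShadow.IsState ρ →
                1 - δ ≤ D.prob ρ N
                  {data | ∀ i j : Fin n,
                    ‖est data i j - (ρ * FermionShadow.oneBody leaf i j).trace‖ ≤ ε} := by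
  refine ⟨1681, 2, by norm_num, fun n hn =>
    ⟨FermionShadow.weight_leafString_le, ?_⟩⟩
  obtain ⟨g, hg⟩ := FermionShadow.exists_balanced_axes hn
  refine ⟨FermionShadow.mirrorCircuit g, le_rfl, fun r => le_rfl,
    FermionShadow.mirrorCircuit_measuresPaulis g, fun leaf ε δ hε hnε hδ hδ1 => ?_⟩
  obtain ⟨N, hN, hNle, hNδ⟩ := FermionShadow.exists_sample_size hn hε hnε hδ hδ1
  let mean : (Fin N → (FermionShadow.mirrorCircuit g).Record) →
      Fin (2 * n + 1) → Fin (2 * n + 1) → ℂ := fun data k l =>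
    (N : ℂ)⁻¹ * ∑ t, FermionShadow.pairEstimator g (k, l) (data t)
  refine ⟨N, hNle, fun data i j => (1 / 4 : ℂ) *
    (mean data (leaf (i, 0)) (leaf (j, 0)) + Complex.I * mean data (leaf (i, 0)) (leaf (j, 1)) -
      Complex.I * mean data (leaf (i, 1)) (leaf (j, 0)) + mean data (leaf (i, 1)) (leaf (j, 1))),
    fun ρ hρ => ?_⟩
  have hn0 : (0 : ℝ) < n := by exact_mod_cast (by omega : 0 < n)
  have hfib : ∀ s, (2 : ℝ) ^ (2 * n) / ((Finset.univ.filter fun r => g r = s).card : ℝ) ≤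
      15 * n := fun s =>
    div_le_of_le_mul₀ (Nat.cast_nonneg _) (by positivity) (hg s)
  have hfib0 : ∀ s, (Finset.univ.filter fun r => g r = s).card ≠ 0 := fun s h0 => by
    have := hg s
    rw [h0, Nat.cast_zero, mul_zero] at this
    exact absurd this (not_le.mpr (by positivity))
  have hε4 : ε ≤ 4 := by
    have h1 : (1 : ℝ) ≤ 1 / ε ^ 2 := le_trans (by exact_mod_cast (by omega : 1 ≤ n)) hnε
    rw [le_div_iff₀ (by positivity)] at h1
    nlinarith
  have key := FermionShadow.one_sub_le_sum_indicator
    (q := FermionShadow.mirrorProb g ρ)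
    (X := FermionShadow.pairEstimator g)
    (μ := fun k => (ρ * (FermionShadow.treeMajorana n k.1 *
      FermionShadow.treeMajorana n k.2)).trace)
    (B := 15 * n) (ε := ε) (N := N)
    (FermionShadow.mirrorProb_nonneg g hρ) (FermionShadow.sum_mirrorProb g hρ) (by positivity)
    (fun k x => (FermionShadow.norm_pairEstimator_le k x).trans (by
      split_ifs
      · exact hfib _
      · positivity))
    (fun k => (FermionShadow.sum_mirrorProb_mul_norm_sq_le hρ k).trans (hfib _))
    (fun k => FermionShadow.sum_mirrorProb_mul_pairEstimator hρ k (hfib0 _)) hε.le hε4 hN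
  rw [Fintype.card_prod, Fintype.card_fin] at key
  push_cast at key
  refine le_trans (by linarith) (key.trans (Finset.sum_le_sum fun z _ =>
    Set.indicator_le_indicator_of_subset ?_ (fun z => Finset.prod_nonneg fun t _ =>
      FermionShadow.mirrorProb_nonneg g hρ _) z))
  intro z hz i j
  have e := FermionShadow.norm_quarter_sum_le (hz (leaf (i, 0), leaf (j, 0)))
    (hz (leaf (i, 0), leaf (j, 1))) (hz (leaf (i, 1), leaf (j, 0)))
    (hz (leaf (i, 1), leaf (j, 1)))
  refine le_trans (le_of_eq (congrArg norm ?_)) e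
  rw [FermionShadow.trace_mul_oneBody]
  ring
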